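/- Let $N\ge 1$ and let $\mathcal G$ be $\mathrm U(N)$, with $d(N)=N^2$, or $\mathrm{SU}(N)$ with $N\ge 2$, with $d(N)=N^2-1$. Let $d\in\{2,3,4\}$ and $0<g_0<\infty$. For $L\in\mathbb N$, $L\ge 1$, and $a\in(0,1]$ let $\Lambda\subset a\mathbb Z^d$ be a hypercubic lattice with $L$ sites on each side, with coordinates $x=(x^0,\dots,x^{d-1})$, and let its bonds $b_\nu(x)$ be the pairs $(x,x+ae^\nu)$ of nearest neighbours that both lie in $\Lambda$ (free boundary conditions). To each bond $b$ is assigned a variable $g_b\in\mathcal G$. A plaquette $p$ in the $\mu$-$\nu$ plane, $\mu<\nu$, is given by sites $x$, $x+ae^\mu$, $x+ae^\mu+ae^\nu$, $x+ae^\nu$ of $\Lambda$; put $$U_p=g_{x,x+ae^\mu}\,g_{x+ae^\mu,x+ae^\mu+ae^\nu}\,g^{-1}_{x+ae^\nu,x+ae^\nu+ae^\mu}\,g^{-1}_{x,x+ae^\nu},\qquad \mathcal A_p=\|1-U_p\|_{H\text{-}S}^2,$$ where $\|M\|_{H\text{-}S}^2=\mathrm{Tr}(M^\dagger M)$. For $g^2>0$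 let $$Z_{\Lambda,a}=\int\exp\Big[-\frac{a^{d-4}}{g^2}\sum_p\mathcal A_p\Big]\,d\tilde g,$$ where $d\tilde g$ is the product over the bonds of $\Lambda$ of the normalized Haar measures on $\mathcal G$. Let $\Lambda_r$ be the number of bonds that are retained after enhanced temporal gauge fixing, i.e. of the bonds $b_\nu(x)$ such that some coordinate $x^\mu$ with $\mu<\nu$ is not the smallest possible one. Put $$Z^n_{\Lambda,a}=\Big(\frac{a^{d-4}}{g^2}\Big)^{d(N)\Lambda_r/2}Z_{\Lambda,a}$$ and, for $L\ge 2$, $$f_{\Lambda,a}=\frac{\ln Z_{\Lambda,a}}{d(N)\Lambda_r},\qquad f^n_{\Lambda,a}=\frac{\ln Z^n_{\Lambda,a}}{d(N)\Lambda_r}.$$ Then there are finite constants $c_\ell,c_u\in\mathbb R$, independent of $L$, of $a\in(0,1]$ and of $g^2\in(0,g_0^2]$, such that the following holds. 1. For all $L\ge1$, $a\in(0,1]$ and $g^2\in(0,g_0^2]$, $$\exp[c_\ell\, d(N)\Lambda_r]\le Z^n_{\Lambda,a}\le \exp[c_u\, d(N)\Lambda_r].$$ 2. The singular behaviour of the free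 energy of the finite lattice is thereby isolated: for all $L\ge 2$, $a\in(0,1]$ and $g^2\in(0,g_0^2]$, $$f_{\Lambda,a}=-\tfrac12\ln\frac{a^{d-4}}{g^2}+f^n_{\Lambda,a},\qquad c_\ell\le f^n_{\Lambda,a}\le c_u.$$ 3. (Thermodynamic limit.) For all $a\in(0,1]$ and $g^2\in(0,g_0^2]$, every sequence of lattices with $L\to\infty$ has a subsequence along which $f^n_{\Lambda,a}$ converges to a finite limit. 4. (Continuum limit.) Let $a_k\in(0,1]$ with $a_k\to0$, let $g_k^2\in(0,g_0^2]$ (for instance constant), and for each $k$ let $F_k\in\mathbb R$ be any limit of $f^n_{\Lambda,a_k}$, at coupling $g_k^2$, along some sequence of lattices with $L\to\infty$. Then $(F_k)$ has a subsequence that converges to a finite limit. -/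

import Mathlib

open MeasureTheory Filter Topology

noncomputable section

namespace LatticeYM

/-! ### The gauge group -/

/-- The unitary group carries its Borel sigma-algebra. -/
instance (N : ℕ) : MeasurableSpace (Matrix.unitaryGroup (Fin N) ℂ) := borel _

instance (N : ℕ) : BorelSpace (Matrix.unitaryGroup (Fin N) ℂ) := ⟨rfl⟩

/-- The two families of gauge groups. -/
inductive GaugeFamily : Type
  | U : GaugeFamily
  | SU : GaugeFamily

/-- `U(N)`, respectively `SU(N)`, as a group of unitary `N × N` matrices. -/
def GaugeFamily.group : GaugeFamily → (N : ℕ) → Subgroup (Matrix.unitaryGroup (Fin N) ℂ)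
  | .U, _ => ⊤
  | .SU, N =>
      { carrier := {A | (A : Matrix (Fin N) (Fin N) ℂ).det = 1}
        mul_mem' := by
          intro A B hA hB
          simp only [Set.mem_ofPred_eq] at hA hB ⊢
          simp [Matrix.det_mul, hA, hB]
        one_mem' := by simp
        inv_mem' := by
          intro A hA
          simp only [Set.mem_ofPred_eq] at hA ⊢
          have h : (A : Matrix (Fin N) (Fin N) ℂ) * (A⁻¹ : Matrix.unitaryGroup (Fin N) ℂ) = 1 :=
            congrArg Subtype.val (mul_inv_cancel A)
          have h' := congrArg Matrix.det h
          rw [Matrix.det_mul, hA, one_mul, Matrix.det_one] at h'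
          exact h' }

/-- The dimension `d(N)` of the Lie algebra of the gauge group: `N²` for `U(N)`,
`N² - 1` for `SU(N)` (where `N ≥ 1`). -/
def GaugeFamily.dim : GaugeFamily → ℕ → ℕ
  | .U, N => N ^ 2
  | .SU, N => N ^ 2 - 1

theorem isCompact_unitaryGroup (N : ℕ) :
    IsCompact (Matrix.unitaryGroup (Fin N) ℂ : Set (Matrix (Fin N) (Fin N) ℂ)) := by
  have hK : IsCompact {A : Matrix (Fin N) (Fin N) ℂ |
      ∀ i, A i ∈ {r : Fin N → ℂ | ∀ j, r j ∈ Metric.closedBall (0 : ℂ) 1}} :=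
    isCompact_pi_infinite fun _ => isCompact_pi_infinite fun _ => isCompact_closedBall _ _
  refine hK.of_isClosed_subset ?_ ?_
  · have : (Matrix.unitaryGroup (Fin N) ℂ : Set (Matrix (Fin N) (Fin N) ℂ)) =
        {A | A * star A = 1} := by
      ext A
      exact Matrix.mem_unitaryGroup_iff
    rw [this]
    exact isClosed_eq (by fun_prop) continuous_const
  · intro A hA i j
    simpa using entry_norm_bound_of_unitary hA i j

instance (N : ℕ) : CompactSpace (Matrix.unitaryGroup (Fin N) ℂ) :=
  isCompact_iff_compactSpace.1 (isCompact_unitaryGroup N)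

instance (𝒢 : GaugeFamily) (N : ℕ) : CompactSpace (𝒢.group N) := by
  refine isCompact_iff_compactSpace.1 (IsClosed.isCompact ?_)
  cases 𝒢 with
  | U => exact isClosed_univ
  | SU =>
    exact isClosed_eq (Continuous.matrix_det continuous_subtype_val) continuous_const

/-- The normalized Haar measure of the gauge group (total mass one). -/
def haarProb (𝒢 : GaugeFamily) (N : ℕ) : Measure (𝒢.group N) :=
  Measure.haarMeasure ⊤

/-! ### The finite lattice -/

/-- The sites of the hypercubic lattice `Λ ⊂ aℤ^d` with `L` sites on each side, given by their
integer coordinates `0, …, L - 1` in units of the spacing `a`; the coordinate `0` is the time. -/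
abbrev Site (d L : ℕ) : Type := Fin d → Fin L

/-- The neighbour `x + a e^ν` of `x`, for `x` not on the last hyperplane of direction `ν`. -/
def Site.succ {d L : ℕ} (x : Site d L) (ν : Fin d) (h : (x ν : ℕ) + 1 < L) : Site d L :=
  Function.update x ν ⟨(x ν : ℕ) + 1, h⟩

theorem Site.succ_of_ne {d L : ℕ} (x : Site d L) {μ ν : Fin d} (h : (x μ : ℕ) + 1 < L)
    (hne : ν ≠ μ) : x.succ μ h ν = x ν := by
  simp [Site.succ, Function.update_of_ne hne]

/-- The bonds `b_ν(x)`, from `x` to `x + a e^ν`, both end points being sites of the lattice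
(free boundary conditions). Each unoriented nearest-neighbour bond occurs exactly once. -/
structure Bond (d L : ℕ) : Type where
  base : Site d L
  dir : Fin d
  inside : (base dir : ℕ) + 1 < L

/-- The plaquettes in the `μ`-`ν` plane, `μ < ν`, with vertices `x`, `x + a e^μ`,
`x + a e^μ + a e^ν`, `x + a e^ν` in the lattice. -/
structure Plaquette (d L : ℕ) : Type where
  base : Site d L
  μ : Fin d
  ν : Fin d
  lt : μ < ν
  inside_μ : (base μ : ℕ) + 1 < L
  inside_ν : (base ν : ℕ) + 1 < L

/-- Bonds as a subtype of a finite type. -/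
def Bond.equiv (d L : ℕ) :
    {b : Site d L × Fin d // (b.1 b.2 : ℕ) + 1 < L} ≃ Bond d L where
  toFun b := ⟨b.1.1, b.1.2, b.2⟩
  invFun b := ⟨(b.base, b.dir), b.inside⟩
  left_inv _ := rfl
  right_inv _ := rfl

/-- Plaquettes as a subtype of a finite type. -/
def Plaquette.equiv (d L : ℕ) :
    {p : Site d L × Fin d × Fin d //
      p.2.1 < p.2.2 ∧ (p.1 p.2.1 : ℕ) + 1 < L ∧ (p.1 p.2.2 : ℕ) + 1 < L} ≃ Plaquette d L where
  toFun p := ⟨p.1.1, p.1.2.1, p.1.2.2, p.2.1, p.2.2.1, p.2.2.2⟩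
  invFun p := ⟨(p.base, p.μ, p.ν), p.lt, p.inside_μ, p.inside_ν⟩
  left_inv _ := rfl
  right_inv _ := rfl

instance (d L : ℕ) : Fintype (Bond d L) := Fintype.ofEquiv _ (Bond.equiv d L)

instance (d L : ℕ) : Fintype (Plaquette d L) := Fintype.ofEquiv _ (Plaquette.equiv d L)

namespace Plaquette

variable {d L : ℕ}

/-- The bond from `x` to `x + a e^μ`. -/
def bond₁ (p : Plaquette d L) : Bond d L := ⟨p.base, p.μ, p.inside_μ⟩

/-- The bond from `x + a e^μ` to `x + a e^μ + a e^ν`. -/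
def bond₂ (p : Plaquette d L) : Bond d L :=
  ⟨p.base.succ p.μ p.inside_μ, p.ν, by
    rw [Site.succ_of_ne _ _ p.lt.ne']; exact p.inside_ν⟩

/-- The bond from `x + a e^ν` to `x + a e^ν + a e^μ`. -/
def bond₃ (p : Plaquette d L) : Bond d L :=
  ⟨p.base.succ p.ν p.inside_ν, p.μ, by
    rw [Site.succ_of_ne _ _ p.lt.ne]; exact p.inside_μ⟩

/-- The bond from `x` to `x + a e^ν`. -/
def bond₄ (p : Plaquette d L) : Bond d L := ⟨p.base, p.ν, p.inside_ν⟩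

end Plaquette

/-- The bonds that the enhanced temporal gauge sets to the identity: `b_ν(x)` is gauged away when
all coordinates of `x` that precede `ν` take their first value. So all `b_0(x)` are gauged away,
`b_1(x)` on the hyperplane of initial time, `b_2(x)` where moreover `x^1` is minimal, and so
on. -/
def Bond.GaugedAway {d L : ℕ} (b : Bond d L) : Prop := ∀ μ : Fin d, μ < b.dir → (b.base μ : ℕ) = 0

/-- `Λ_r`: the number of bonds retained after enhanced temporal gauge fixing. -/
def retained (d L : ℕ) : ℕ := Nat.card {b : Bond d L // ¬ b.GaugedAway}

/-! ### The model -/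

/-- Square of the Hilbert-Schmidt norm, `Tr (M† M)`. -/
def hsNormSq {N : ℕ} (M : Matrix (Fin N) (Fin N) ℂ) : ℝ := (M.conjTranspose * M).trace.re

section Model

variable {𝒢 : GaugeFamily} {N d L : ℕ}

/-- The plaquette variable `U_p = U_1 U_2 U_3 U_4`, the last two factors being the inverses of
the bond variables. -/
def plaquetteVar (u : Bond d L → 𝒢.group N) (p : Plaquette d L) : 𝒢.group N :=
  u p.bond₁ * u p.bond₂ * (u p.bond₃)⁻¹ * (u p.bond₄)⁻¹

/-- The Wilson action of one plaquette, `A_p = ‖1 - U_p‖²` in the Hilbert-Schmidt norm. -/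
def plaquetteAction (u : Bond d L → 𝒢.group N) (p : Plaquette d L) : ℝ :=
  hsNormSq (1 - ((plaquetteVar u p : Matrix.unitaryGroup (Fin N) ℂ) : Matrix (Fin N) (Fin N) ℂ))

end Model

/-- The factor `a^{d-4} / g²`. -/
def coupling (d : ℕ) (a g : ℝ) : ℝ := a ^ ((d : ℤ) - 4) / g ^ 2

/-- The partition function `Z_{Λ,a}`: the integral of `exp (- (a^{d-4}/g²) ∑_p A_p)` with respect
to the product over all bonds of the normalized Haar measures. -/
def partitionFn (𝒢 : GaugeFamily) (N d L : ℕ) (a g : ℝ) : ℝ :=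
  ∫ u : Bond d L → 𝒢.group N,
    Real.exp (-(coupling d a g * ∑ p : Plaquette d L, plaquetteAction u p))
    ∂(Measure.pi fun _ => haarProb 𝒢 N)

/-- The normalized partition function
`Z^n_{Λ,a} = (a^{d-4}/g²)^{d(N) Λ_r / 2} Z_{Λ,a}`. -/
def normPartitionFn (𝒢 : GaugeFamily) (N d L : ℕ) (a g : ℝ) : ℝ :=
  coupling d a g ^ (((𝒢.dim N : ℝ) * (retained d L : ℝ)) / 2) * partitionFn 𝒢 N d L a g

/-- The free energy `f_{Λ,a} = ln Z_{Λ,a} / (d(N) Λ_r)`. -/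
def freeEnergy (𝒢 : GaugeFamily) (N d L : ℕ) (a g : ℝ) : ℝ :=
  Real.log (partitionFn 𝒢 N d L a g) / ((𝒢.dim N : ℝ) * (retained d L : ℝ))

/-- The normalized free energy `f^n_{Λ,a} = ln Z^n_{Λ,a} / (d(N) Λ_r)`. -/
def normFreeEnergy (𝒢 : GaugeFamily) (N d L : ℕ) (a g : ℝ) : ℝ :=
  Real.log (normPartitionFn 𝒢 N d L a g) / ((𝒢.dim N : ℝ) * (retained d L : ℝ))

end LatticeYM

end

/-! Write `β` for `coupling d a g`. Haar balls of small radius `r` have volume of order `r ^ dim`,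
so one group variable with Gaussian weight `exp (-β dist²)` contributes a factor of order `β ^ (-dim
/ 2)`. The theorem says that the partition function behaves like one such factor per retained bond;
the normalization cancels these powers of `β`.

Upper bound (`lintegral_action_le`): every retained bond is the top edge of some plaquette. Keep one
such plaquette per retained bond, drop the rest of the nonnegative action, and integrate the bonds
from the top down. By invariance of Haar measure each integration gives the same one-variable
integral, so no gauge has to be fixed.

Lower bound (`le_lintegral_action`): keep only configurations whose gauge-fixed retained variables
lie within `β ^ (-1/2)` of the identity. Their measure is a power of one ball volume, each plaquette
costs at most `16` in the exponent, and there are at most `d` plaquettes per retained bond.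

The ball volumes come from the exponential chart, which is bi-Lipschitz near `0`, by double counting
(`lintegral_measure_near`) and without a density for Haar measure. Both limits are then compactness
of `[cl, cu]`. -/

open scoped Pointwise

noncomputable section

namespace LatticeYM

/-! ### Volume of small balls for an invariant measure -/

section BallVolume

theorem measure_ball_eq {G : Type*} [Group G] [PseudoMetricSpace G] [IsIsometricSMul G G]
    [MeasurableSpace G] [BorelSpace G] (μ : Measure G) [μ.IsMulLeftInvariant] (g : G) (r : ℝ) :
    μ (Metric.ball g r) = μ (Metric.ball 1 r) := by
  have h : Metric.ball g r = g • Metric.ball (1 : G) r := by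
    rw [Metric.smul_ball, smul_eq_mul, mul_one]
  rw [h, measure_smul]

/-- A polynomial bound on the volume of balls bounds Gaussian integrals. -/
theorem exists_lintegral_exp_le {G : Type*} [Group G] [PseudoMetricSpace G]
    [MeasurableSpace G] [BorelSpace G] (μ : Measure G) {D : ℕ} {C : ℝ} (hC : 0 < C)
    (h : ∀ r : ℝ, 0 < r → μ (Metric.ball 1 r) ≤ ENNReal.ofReal (C * r ^ D)) :
    ∃ C' : ℝ, 0 < C' ∧ ∀ β : ℝ, 0 < β →
      ∫⁻ g, ENNReal.ofReal (Real.exp (-(β * dist g 1 ^ 2))) ∂μ ≤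
        ENNReal.ofReal (C' * (√β)⁻¹ ^ D) := by
  have hsum : Summable fun k : ℕ => ((k : ℝ) + 1) ^ D * Real.exp (-(k : ℝ)) := by
    have h0 := (summable_nat_add_iff 1).2 (Real.summable_pow_mul_exp_neg_nat_mul D one_pos)
    refine (h0.mul_left (Real.exp 1)).congr fun k => ?_
    have : Real.exp (-(k : ℝ)) = Real.exp 1 * Real.exp (-1 * ((k + 1 : ℕ) : ℝ)) := by
      rw [← Real.exp_add]; congr 1; push_cast; ring
    rw [this]; push_cast; ring
  refine ⟨C * ∑' k : ℕ, ((k : ℝ) + 1) ^ D * Real.exp (-(k : ℝ)),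
    mul_pos hC (hsum.tsum_pos (fun k => by positivity) 0 (by positivity)), fun β hβ => ?_⟩
  have hsβ : 0 < √β := Real.sqrt_pos.2 hβ
  calc ∫⁻ g, ENNReal.ofReal (Real.exp (-(β * dist g 1 ^ 2))) ∂μ
      ≤ ∫⁻ g, ∑' k : ℕ, (Metric.ball (1 : G) (√(k + 1) * (√β)⁻¹)).indicator
          (fun _ => ENNReal.ofReal (Real.exp (-(k : ℝ)))) g ∂μ := by
        refine lintegral_mono fun g => ?_
        set s : ℝ := β * dist g 1 ^ 2
        have hs : 0 ≤ s := by positivity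
        -- Slicing by the integer part of `s = β dist²`: the term `k = ⌊s⌋` alone dominates, since
        -- `s < k + 1` puts `g` in the `k`-th ball and `exp (-s) ≤ exp (-k)`.
        refine le_trans ?_ (ENNReal.le_tsum ⌊s⌋₊)
        have hg : g ∈ Metric.ball (1 : G) (√(⌊s⌋₊ + 1) * (√β)⁻¹) := by
          rw [Metric.mem_ball, ← div_eq_mul_inv, lt_div_iff₀ hsβ]
          refine Real.lt_sqrt_of_sq_lt ?_
          rw [mul_pow, Real.sq_sqrt hβ.le, mul_comm]
          exact Nat.lt_floor_add_one s
        rw [Set.indicator_of_mem hg]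
        exact ENNReal.ofReal_le_ofReal (Real.exp_le_exp.2 (neg_le_neg (Nat.floor_le hs)))
    _ = ∑' k : ℕ, ENNReal.ofReal (Real.exp (-(k : ℝ))) *
          μ (Metric.ball (1 : G) (√(k + 1) * (√β)⁻¹)) := by
        rw [lintegral_tsum fun k =>
          (measurable_const.indicator measurableSet_ball).aemeasurable]
        exact tsum_congr fun k => lintegral_indicator_const measurableSet_ball _
    _ ≤ ∑' k : ℕ, ENNReal.ofReal (C * (√β)⁻¹ ^ D * (((k : ℝ) + 1) ^ D * Real.exp (-(k : ℝ)))) := by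
        refine ENNReal.tsum_le_tsum fun k => ?_
        have h1 : √((k : ℝ) + 1) ≤ k + 1 := by
          rw [Real.sqrt_le_left (by positivity)]
          nlinarith [(Nat.cast_nonneg k : (0 : ℝ) ≤ k)]
        refine (mul_le_mul_right (h _ (by positivity)) _).trans ?_
        rw [← ENNReal.ofReal_mul (Real.exp_nonneg _)]
        refine ENNReal.ofReal_le_ofReal ?_
        rw [mul_pow]
        have h2 : √((k : ℝ) + 1) ^ D ≤ ((k : ℝ) + 1) ^ D := by gcongr
        calc _ = C * (√β)⁻¹ ^ D * (√((k : ℝ) + 1) ^ D * Real.exp (-(k : ℝ))) := by ring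
          _ ≤ _ := by gcongr
    _ = _ := by
        rw [← ENNReal.ofReal_tsum_of_nonneg (fun k => by positivity) (hsum.mul_left _),
          tsum_mul_left]
        congr 1
        ring

variable {G E : Type*} [Group G] [PseudoMetricSpace G] [IsIsometricSMul G G]
  [SecondCountableTopology G] [MeasurableSpace G] [BorelSpace G]
  [NormedAddCommGroup E]

open Module (finrank)

/-- A bi-Lipschitz parametrization of a neighbourhood of the identity by a ball. -/
structure IsLocalChart (φ : E → G) (ρ K δ : ℝ) : Prop where
  continuous : Continuous φ
  radius_pos : 0 < ρ
  const_pos : 0 < K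
  nhd_pos : 0 < δ
  norm_le : ∀ X ∈ Metric.ball (0 : E) ρ, ∀ Y ∈ Metric.ball (0 : E) ρ,
    ‖X - Y‖ ≤ K * dist (φ X) (φ Y)
  dist_le : ∀ X ∈ Metric.ball (0 : E) ρ, ∀ Y ∈ Metric.ball (0 : E) ρ,
    dist (φ X) (φ Y) ≤ K * ‖X - Y‖
  surj : Metric.ball (1 : G) δ ⊆ φ '' Metric.ball (0 : E) (ρ / 2)

/-- Fubini's theorem for the incidence relation `dist (φ X) g < r`. -/
theorem lintegral_measure_near [MeasurableSpace E] [BorelSpace E] (μ : Measure G) [IsFiniteMeasure μ] [μ.IsMulLeftInvariant]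
    (ν : Measure E) [SFinite ν] {φ : E → G} (hφ : Continuous φ) (ρ r : ℝ) :
    ∫⁻ g, ν (Metric.ball 0 ρ ∩ {X | dist (φ X) g < r}) ∂μ =
      ν (Metric.ball 0 ρ) * μ (Metric.ball 1 r) := by
  have hS : MeasurableSet {q : E × G | q.1 ∈ Metric.ball (0 : E) ρ ∧ dist (φ q.1) q.2 < r} :=
    (measurableSet_ball.preimage measurable_fst).inter
      (isOpen_lt ((hφ.comp continuous_fst).dist continuous_snd) continuous_const).measurableSet
  have h1 := Measure.prod_apply (μ := ν) (ν := μ) hS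
  have h2 := Measure.prod_apply_symm (μ := ν) (ν := μ) hS
  rw [h1] at h2
  refine h2.symm.trans ?_
  have h3 : ∀ X : E, μ (Prod.mk X ⁻¹'
      {q : E × G | q.1 ∈ Metric.ball (0 : E) ρ ∧ dist (φ q.1) q.2 < r}) =
      (Metric.ball (0 : E) ρ).indicator (fun _ => μ (Metric.ball 1 r)) X := by
    intro X
    by_cases hX : X ∈ Metric.ball (0 : E) ρ
    · rw [Set.indicator_of_mem hX, ← measure_ball_eq μ (φ X)]
      congr 1
      ext g
      exact ⟨fun h => by rw [Metric.mem_ball, dist_comm]; exact h.2,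
        fun h => ⟨hX, by rw [Metric.mem_ball, dist_comm] at h; exact h⟩⟩
    · rw [Set.indicator_of_notMem hX]
      have : Prod.mk X ⁻¹' {q : E × G | q.1 ∈ Metric.ball (0 : E) ρ ∧ dist (φ q.1) q.2 < r}
          = ∅ := by
        exact Set.eq_empty_of_forall_notMem fun g h => hX h.1
      rw [this, measure_empty]
  simp_rw [h3]
  rw [lintegral_indicator_const measurableSet_ball, mul_comm]

variable [NormedSpace ℝ E] [FiniteDimensional ℝ E] (μ : Measure G) [IsProbabilityMeasure μ] [μ.IsMulLeftInvariant]

/-- Double counting of pairs `(X, g)` with `dist (φ X) g < r`. For fixed `g`, two admissible `X`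
have images less than `2 r` apart, so all of them lie in one ball of radius `2 K r`; for fixed `X`,
invariance gives the volume of the ball at `1`. -/
theorem exists_measure_ball_le {φ : E → G} {ρ K δ : ℝ} (hφ : IsLocalChart φ ρ K δ) :
    ∃ C : ℝ, 0 < C ∧ ∀ r : ℝ, 0 < r →
      μ (Metric.ball 1 r) ≤ ENNReal.ofReal (C * r ^ finrank ℝ E) := by
  borelize E
  set ν : Measure E := Measure.addHaar
  have hρ : 0 < ν (Metric.ball 0 ρ) := Metric.measure_ball_pos ν 0 hφ.radius_pos
  have hρ' : ν (Metric.ball 0 ρ) ≠ ⊤ := measure_ball_lt_top.ne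
  have h1 : 0 < ν (Metric.ball 0 1) := Metric.measure_ball_pos ν 0 one_pos
  have h1' : ν (Metric.ball 0 1) ≠ ⊤ := measure_ball_lt_top.ne
  have hK := hφ.const_pos
  refine ⟨(2 * K) ^ finrank ℝ E * ((ν (Metric.ball 0 1)).toReal / (ν (Metric.ball 0 ρ)).toReal),
    mul_pos (by positivity) (div_pos (ENNReal.toReal_pos h1.ne' h1')
      (ENNReal.toReal_pos hρ.ne' hρ')), fun r hr => ?_⟩
  have key : ν (Metric.ball 0 ρ) * μ (Metric.ball 1 r) ≤
      ENNReal.ofReal ((2 * K * r) ^ finrank ℝ E) * ν (Metric.ball 0 1) := by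
    rw [← lintegral_measure_near μ ν hφ.continuous]
    calc _ ≤ ∫⁻ _ : G, ENNReal.ofReal ((2 * K * r) ^ finrank ℝ E) * ν (Metric.ball 0 1) ∂μ := by
          refine lintegral_mono fun g => ?_
          rcases Set.eq_empty_or_nonempty (Metric.ball 0 ρ ∩ {X | dist (φ X) g < r}) with h | h
          · simp [h]
          · obtain ⟨X₀, hX₀, hg₀⟩ := h
            rw [← Measure.addHaar_ball_of_pos ν X₀ (by positivity : 0 < 2 * K * r)]
            refine measure_mono fun X ⟨hX, hg⟩ => ?_
            rw [mem_ball_iff_norm]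
            refine (hφ.norm_le X hX X₀ hX₀).trans_lt ?_
            have : dist (φ X) (φ X₀) < 2 * r := by
              have := dist_triangle_right (φ X) (φ X₀) g
              simp only [Set.mem_ofPred_eq] at hg hg₀
              linarith
            nlinarith
      _ = _ := by simp
  have h2 : μ (Metric.ball 1 r) ≤
      ENNReal.ofReal ((2 * K * r) ^ finrank ℝ E) * ν (Metric.ball 0 1) / ν (Metric.ball 0 ρ) := by
    rw [ENNReal.le_div_iff_mul_le (Or.inl hρ.ne') (Or.inl hρ'), mul_comm]
    exact key
  refine h2.trans_eq ?_
  rw [← ENNReal.ofReal_toReal h1', ← ENNReal.ofReal_toReal hρ',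
    ← ENNReal.ofReal_mul (by positivity), ← ENNReal.ofReal_div_of_pos
      (ENNReal.toReal_pos hρ.ne' hρ')]
  rw [ENNReal.ofReal_toReal h1', ENNReal.ofReal_toReal hρ', mul_pow (2 * K)]
  congr 1
  ring

/-- The same double counting from below: each `g` within `δ` of `1` is some `φ X₀`, and a whole ball
of radius proportional to `r` around `X₀` is admissible. -/
theorem exists_le_measure_ball [μ.IsOpenPosMeasure] {φ : E → G} {ρ K δ : ℝ}
    (hφ : IsLocalChart φ ρ K δ) {R : ℝ} (hR : 0 < R) :
    ∃ c : ℝ, 0 < c ∧ ∀ r : ℝ, 0 < r → r ≤ R →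
      ENNReal.ofReal (c * r ^ finrank ℝ E) ≤ μ (Metric.ball 1 r) := by
  borelize E
  set ν : Measure E := Measure.addHaar
  have hρ : 0 < ν (Metric.ball 0 ρ) := Metric.measure_ball_pos ν 0 hφ.radius_pos
  have hρ' : ν (Metric.ball 0 ρ) ≠ ⊤ := measure_ball_lt_top.ne
  have h1 : 0 < ν (Metric.ball 0 1) := Metric.measure_ball_pos ν 0 one_pos
  have h1' : ν (Metric.ball 0 1) ≠ ⊤ := measure_ball_lt_top.ne
  have hδ : 0 < μ (Metric.ball 1 δ) := Metric.measure_ball_pos μ 1 hφ.nhd_pos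
  have hδ' : μ (Metric.ball 1 δ) ≠ ⊤ := measure_ne_top _ _
  have hK := hφ.const_pos
  have hρ0 := hφ.radius_pos
  -- `1 / K` keeps the image of the ball of radius `k r` within `r` of `g`; `ρ / (2 R)` gives `k r ≤
  -- ρ / 2`, so this ball stays in the chart when `‖X₀‖ < ρ / 2`.
  set k : ℝ := min (1 / K) (ρ / (2 * R))
  have hk : 0 < k := by positivity
  have hkK : k * K ≤ 1 := by
    have : k ≤ 1 / K := min_le_left _ _
    rwa [le_div_iff₀ hK] at this
  have hkR : k * (2 * R) ≤ ρ := by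
    have : k ≤ ρ / (2 * R) := min_le_right _ _
    rwa [le_div_iff₀ (by positivity)] at this
  refine ⟨k ^ finrank ℝ E * ((ν (Metric.ball 0 1)).toReal * (μ (Metric.ball 1 δ)).toReal /
      (ν (Metric.ball 0 ρ)).toReal),
    mul_pos (by positivity) (div_pos (mul_pos (ENNReal.toReal_pos h1.ne' h1')
      (ENNReal.toReal_pos hδ.ne' hδ')) (ENNReal.toReal_pos hρ.ne' hρ')), fun r hr hrR => ?_⟩
  have key : ENNReal.ofReal ((k * r) ^ finrank ℝ E) * ν (Metric.ball 0 1) * μ (Metric.ball 1 δ) ≤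
      ν (Metric.ball 0 ρ) * μ (Metric.ball 1 r) := by
    rw [← lintegral_measure_near μ ν hφ.continuous, ← lintegral_indicator_const measurableSet_ball]
    refine lintegral_mono fun g => ?_
    by_cases hg : g ∈ Metric.ball 1 δ
    · rw [Set.indicator_of_mem hg]
      obtain ⟨X₀, hX₀, rfl⟩ := hφ.surj hg
      rw [← Measure.addHaar_ball_of_pos ν X₀ (by positivity : 0 < k * r)]
      refine measure_mono fun X hX => ?_
      rw [mem_ball_iff_norm] at hX
      rw [mem_ball_zero_iff] at hX₀
      have hkr : k * r ≤ ρ / 2 := by nlinarith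
      have hXρ : X ∈ Metric.ball (0 : E) ρ := by
        rw [mem_ball_zero_iff]
        have := norm_add_le (X - X₀) X₀
        rw [sub_add_cancel] at this
        linarith
      refine ⟨hXρ, ?_⟩
      have := hφ.dist_le X hXρ X₀ (by rw [mem_ball_zero_iff]; linarith)
      simp only [Set.mem_ofPred_eq]
      nlinarith
    · rw [Set.indicator_of_notMem hg]
      exact zero_le
  have h2 : ENNReal.ofReal ((k * r) ^ finrank ℝ E) * ν (Metric.ball 0 1) * μ (Metric.ball 1 δ)
      / ν (Metric.ball 0 ρ) ≤ μ (Metric.ball 1 r) := by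
    refine ENNReal.div_le_of_le_mul ?_
    rw [mul_comm (μ _)]
    exact key
  refine le_trans (le_of_eq ?_) h2
  rw [← ENNReal.ofReal_toReal h1', ← ENNReal.ofReal_toReal hρ', ← ENNReal.ofReal_toReal hδ',
    ← ENNReal.ofReal_mul (by positivity), ← ENNReal.ofReal_mul (by positivity),
    ← ENNReal.ofReal_div_of_pos (ENNReal.toReal_pos hρ.ne' hρ')]
  rw [ENNReal.ofReal_toReal h1', ENNReal.ofReal_toReal hρ', ENNReal.ofReal_toReal hδ', mul_pow k]
  congr 1
  ring

end BallVolume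

/-! ### The invariant Hilbert-Schmidt metric on the gauge group -/

section

theorem isIsometricSMul_of_dist_mul_left {G : Type*} [Group G] [PseudoMetricSpace G]
    (h : ∀ c g k : G, dist (c * g) (c * k) = dist g k) : IsIsometricSMul G G :=
  ⟨fun c => Isometry.of_dist_eq fun g k => h c g k⟩

open scoped Matrix.Norms.Frobenius

theorem hsNormSq_eq_norm_sq {N : ℕ} (M : Matrix (Fin N) (Fin N) ℂ) : hsNormSq M = ‖M‖ ^ 2 := by
  rw [Matrix.frobenius_norm_def, ← Real.sqrt_eq_rpow, Real.sq_sqrt (by positivity), hsNormSq,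
    Matrix.trace, Complex.re_sum, Finset.sum_comm]
  refine Finset.sum_congr rfl fun i _ => ?_
  rw [Matrix.diag_apply, Matrix.mul_apply, Complex.re_sum]
  refine Finset.sum_congr rfl fun j _ => ?_
  rw [Matrix.conjTranspose_apply, Complex.star_def, ← Complex.normSq_eq_conj_mul_self,
    Complex.ofReal_re, Complex.normSq_eq_norm_sq, Real.rpow_two]

theorem norm_unitary_mul {N : ℕ} (A : Matrix.unitaryGroup (Fin N) ℂ)
    (M : Matrix (Fin N) (Fin N) ℂ) : ‖(A : Matrix (Fin N) (Fin N) ℂ) * M‖ = ‖M‖ := by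
  rw [← sq_eq_sq₀ (norm_nonneg _) (norm_nonneg _), ← hsNormSq_eq_norm_sq, ← hsNormSq_eq_norm_sq,
    hsNormSq, hsNormSq, Matrix.conjTranspose_mul, Matrix.mul_assoc, ← Matrix.mul_assoc _ _ M]
  have : (A : Matrix (Fin N) (Fin N) ℂ).conjTranspose * (A : Matrix (Fin N) (Fin N) ℂ) = 1 :=
    Matrix.mem_unitaryGroup_iff'.1 A.2
  rw [this, Matrix.one_mul]

theorem norm_mul_unitary {N : ℕ} (A : Matrix.unitaryGroup (Fin N) ℂ)
    (M : Matrix (Fin N) (Fin N) ℂ) : ‖M * (A : Matrix (Fin N) (Fin N) ℂ)‖ = ‖M‖ := by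
  rw [← Matrix.frobenius_norm_conjTranspose, Matrix.conjTranspose_mul,
    ← Matrix.frobenius_norm_conjTranspose M]
  exact norm_unitary_mul A⁻¹ _

variable {𝒢 : GaugeFamily} {N : ℕ}

/-- `replaceTopology` keeps the subtype topology definitionally, so that the metric is compatible
with the existing Borel structure and Haar measure. -/
instance : PseudoMetricSpace (𝒢.group N) :=
  (PseudoMetricSpace.induced (fun g : 𝒢.group N => ((g : Matrix.unitaryGroup (Fin N) ℂ) :
    Matrix (Fin N) (Fin N) ℂ)) inferInstance).replaceTopology (by
      rw [instTopologicalSpaceSubtype, instTopologicalSpaceSubtype, induced_compose]; rfl)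

theorem dist_group (g h : 𝒢.group N) : dist g h =
    ‖((g : Matrix.unitaryGroup (Fin N) ℂ) : Matrix (Fin N) (Fin N) ℂ) -
      ((h : Matrix.unitaryGroup (Fin N) ℂ) : Matrix (Fin N) (Fin N) ℂ)‖ := by
  exact dist_eq_norm (g.1.1) (h.1.1)

instance : @IsIsometricSMul (𝒢.group N) (𝒢.group N)
    PseudoMetricSpace.toPseudoEMetricSpace _ :=
  isIsometricSMul_of_dist_mul_left fun c g h => by
    rw [dist_group, dist_group, ← norm_unitary_mul (c : Matrix.unitaryGroup (Fin N) ℂ)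
      ((g : Matrix.unitaryGroup (Fin N) ℂ) - _), Matrix.mul_sub]
    rfl

theorem dist_mul_right_group (g h k : 𝒢.group N) : dist (g * k) (h * k) = dist g h := by
  rw [dist_group, dist_group, ← norm_mul_unitary (k : Matrix.unitaryGroup (Fin N) ℂ)
      ((g : Matrix.unitaryGroup (Fin N) ℂ) - _), Matrix.sub_mul]
  rfl

theorem dist_mul_left_group (g h k : 𝒢.group N) : dist (k * g) (k * h) = dist g h :=
  dist_smul k g h

instance : SecondCountableTopology (𝒢.group N) :=
  haveI : SecondCountableTopology (Matrix (Fin N) (Fin N) ℂ) :=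
    inferInstanceAs (SecondCountableTopology (Fin N → Fin N → ℂ))
  haveI : SecondCountableTopology (Matrix.unitaryGroup (Fin N) ℂ) :=
    TopologicalSpace.Subtype.secondCountableTopology _
  TopologicalSpace.Subtype.secondCountableTopology _

instance : (haarProb 𝒢 N).IsHaarMeasure := by unfold haarProb; infer_instance
/-! ### The Lie algebra and the exponential chart -/

/-- The skew-Hermitian matrices as a real vector space. -/
def skewHermitian (N : ℕ) : Submodule ℝ (Matrix (Fin N) (Fin N) ℂ) where
  carrier := {X | X.conjTranspose = -X}
  zero_mem' := by simp
  add_mem' := by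
    intro X Y hX hY
    simp only [Set.mem_ofPred_eq] at *
    rw [Matrix.conjTranspose_add, hX, hY, neg_add]
  smul_mem' := by
    intro c X hX
    simp only [Set.mem_ofPred_eq] at *
    rw [Matrix.conjTranspose_smul, hX, star_trivial, smul_neg]

theorem mem_skewHermitian {X : Matrix (Fin N) (Fin N) ℂ} :
    X ∈ skewHermitian N ↔ X.conjTranspose = -X := Iff.rfl

/-- The imaginary part of the trace. -/
def imTrace (N : ℕ) : Matrix (Fin N) (Fin N) ℂ →ₗ[ℝ] ℝ :=
  Complex.imLm ∘ₗ Matrix.traceLinearMap (Fin N) ℝ ℂ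

theorem imTrace_apply (X : Matrix (Fin N) (Fin N) ℂ) : imTrace N X = X.trace.im := rfl

theorem trace_re_eq_zero {X : Matrix (Fin N) (Fin N) ℂ} (hX : X ∈ skewHermitian N) :
    X.trace.re = 0 := by
  have h := congrArg (fun Y => (Matrix.trace Y).re) (mem_skewHermitian.1 hX)
  simp only [Matrix.trace_conjTranspose, Matrix.trace_neg, Complex.star_def, Complex.conj_re,
    Complex.neg_re] at h
  linarith

/-- The Lie algebra of the gauge group. -/
def lieAlg : GaugeFamily → (N : ℕ) → Submodule ℝ (Matrix (Fin N) (Fin N) ℂ)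
  | .U, N => skewHermitian N
  | .SU, N => skewHermitian N ⊓ LinearMap.ker (imTrace N)

/-- Rank-nullity for `X ↦ X + X†`: the kernel is the skew-Hermitian space and the range is `I` times
it, so twice the dimension is `2 N²`. -/
theorem finrank_skewHermitian (N : ℕ) : Module.finrank ℝ (skewHermitian N) = N ^ 2 := by
  let T : Matrix (Fin N) (Fin N) ℂ →ₗ[ℝ] Matrix (Fin N) (Fin N) ℂ :=
    { toFun := fun X => X + X.conjTranspose
      map_add' := fun X Y => by rw [Matrix.conjTranspose_add]; abel
      map_smul' := fun c X => by
        rw [Matrix.conjTranspose_smul, star_trivial, RingHom.id_apply, smul_add] }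
  let J : Matrix (Fin N) (Fin N) ℂ →ₗ[ℝ] Matrix (Fin N) (Fin N) ℂ :=
    { toFun := fun X => Complex.I • X
      map_add' := fun X Y => smul_add _ _ _
      map_smul' := fun c X => smul_comm _ _ _ }
  have hJ : Function.Injective J := smul_right_injective _ Complex.I_ne_zero
  have hker : LinearMap.ker T = skewHermitian N := by
    ext X
    rw [LinearMap.mem_ker, mem_skewHermitian, eq_neg_iff_add_eq_zero, add_comm]
    rfl
  have hrange : LinearMap.range T = (skewHermitian N).map J := by
    ext Y
    constructor
    · rintro ⟨X, rfl⟩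
      refine ⟨-Complex.I • (X + X.conjTranspose), ?_, ?_⟩
      · change Matrix.conjTranspose _ = _
        rw [Matrix.conjTranspose_smul, Matrix.conjTranspose_add, Matrix.conjTranspose_conjTranspose,
          ← neg_smul, add_comm]
        simp
      · change Complex.I • (-Complex.I • (X + X.conjTranspose)) = X + X.conjTranspose
        rw [smul_smul]; simp
    · rintro ⟨X, hX, rfl⟩
      refine ⟨(Complex.I / 2) • X, ?_⟩
      change (Complex.I / 2) • X + ((Complex.I / 2) • X).conjTranspose = Complex.I • X
      rw [Matrix.conjTranspose_smul, mem_skewHermitian.1 hX, smul_neg, ← neg_smul, ← add_smul]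
      congr 1
      simp [Complex.ext_iff]
      norm_num
  have h := LinearMap.finrank_range_add_finrank_ker T
  rw [hker, hrange, ← (Submodule.equivMapOfInjective J hJ (skewHermitian N)).finrank_eq, Module.finrank_matrix,
    Complex.finrank_real_complex, Fintype.card_fin] at h
  nlinarith

theorem finrank_lieAlg (𝒢 : GaugeFamily) (N : ℕ) (hN : 1 ≤ N) :
    Module.finrank ℝ (lieAlg 𝒢 N) = 𝒢.dim N := by
  cases 𝒢 with
  | U => exact finrank_skewHermitian N
  | SU =>
    let τ : skewHermitian N →ₗ[ℝ] ℝ := (imTrace N).comp (skewHermitian N).subtype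
    have hτ : LinearMap.range τ = ⊤ := by
      -- Imaginary scalar matrices already attain every trace, so tracelessness costs exactly one
      -- dimension.
      refine LinearMap.range_eq_top.2 fun c => ⟨⟨((c / N : ℝ) * Complex.I) • 1, ?_⟩, ?_⟩
      · rw [mem_skewHermitian, Matrix.conjTranspose_smul, Matrix.conjTranspose_one, ← neg_smul]
        simp
      · change (Matrix.trace (((c / N : ℝ) * Complex.I) • (1 : Matrix (Fin N) (Fin N) ℂ))).im = c
        have : (N : ℝ) ≠ 0 := by positivity
        rw [Matrix.trace_smul, Matrix.trace_one, Fintype.card_fin]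
        simp only [smul_eq_mul, Complex.mul_im, Complex.mul_re]
        simp
        field_simp
    have h := LinearMap.finrank_range_add_finrank_ker τ
    rw [hτ, finrank_top, Module.finrank_self, finrank_skewHermitian] at h
    have h2 : lieAlg .SU N = (LinearMap.ker τ).map (skewHermitian N).subtype := by
      ext X
      constructor
      · rintro ⟨h1, h2⟩
        exact ⟨⟨X, h1⟩, h2, rfl⟩
      · rintro ⟨Y, hY, rfl⟩
        exact ⟨Y.2, hY⟩
    have h3 : Module.finrank ℝ ((LinearMap.ker τ).map (skewHermitian N).subtype) =
        Module.finrank ℝ (LinearMap.ker τ) :=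
      (Submodule.equivMapOfInjective (skewHermitian N).subtype Subtype.val_injective
        (LinearMap.ker τ)).finrank_eq.symm
    rw [h2, h3, GaugeFamily.dim]
    omega

/-- The spectral theorem for the Hermitian matrix `-I • X` reduces this to diagonal matrices. -/
theorem det_exp_of_skewHermitian {X : Matrix (Fin N) (Fin N) ℂ} (hX : X ∈ skewHermitian N) :
    (NormedSpace.exp X).det = Complex.exp X.trace := by
  have hH : (-Complex.I • X).IsHermitian := by
    change Matrix.conjTranspose _ = _
    rw [Matrix.conjTranspose_smul, mem_skewHermitian.1 hX, smul_neg, ← neg_smul]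
    simp
  obtain ⟨V, k, hVV, hk⟩ : ∃ (V : Matrix (Fin N) (Fin N) ℂ) (k : Fin N → ℂ),
      V * star V = 1 ∧ -Complex.I • X = V * Matrix.diagonal k * star V :=
    ⟨_, _, Matrix.mem_unitaryGroup_iff.1 hH.eigenvectorUnitary.2, hH.spectral_theorem⟩
  have hVu : IsUnit V := IsUnit.of_mul_eq_one _ hVV
  have hVd : IsUnit V.det := (Matrix.isUnit_iff_isUnit_det _).1 hVu
  obtain ⟨l, hX'⟩ : ∃ l : Fin N → ℂ, X = V * Matrix.diagonal l * V⁻¹ := by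
    refine ⟨Complex.I • k, ?_⟩
    rw [Matrix.inv_eq_right_inv hVV, Matrix.diagonal_smul, Matrix.mul_smul, Matrix.smul_mul, ← hk,
      smul_smul]
    simp
  have htr : X.trace = ∑ i, l i := by
    rw [hX', Matrix.trace_mul_comm, ← Matrix.mul_assoc, Matrix.nonsing_inv_mul _ hVd,
      Matrix.one_mul, Matrix.trace_diagonal]
  rw [htr, hX', Matrix.exp_conj _ _ hVu, Matrix.det_conj hVu, Matrix.exp_diagonal,
    Matrix.det_diagonal, Complex.exp_sum]
  refine Finset.prod_congr rfl fun i _ => ?_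
  rw [Pi.coe_exp, Complex.exp_eq_exp_ℂ]

theorem lieAlg_le_skewHermitian (𝒢 : GaugeFamily) (N : ℕ) : lieAlg 𝒢 N ≤ skewHermitian N := by
  cases 𝒢
  · exact le_rfl
  · exact inf_le_left

theorem exp_mem_unitaryGroup {X : Matrix (Fin N) (Fin N) ℂ} (hX : X ∈ skewHermitian N) :
    NormedSpace.exp X ∈ Matrix.unitaryGroup (Fin N) ℂ := by
  rw [Matrix.mem_unitaryGroup_iff, Matrix.star_eq_conjTranspose, ← Matrix.exp_conjTranspose,
    mem_skewHermitian.1 hX, Matrix.exp_neg]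
  exact Matrix.mul_nonsing_inv _ ((Matrix.isUnit_iff_isUnit_det _).1 (Matrix.isUnit_exp X))

/-- The exponential map of the gauge group. -/
def expMap (𝒢 : GaugeFamily) (N : ℕ) (X : lieAlg 𝒢 N) : 𝒢.group N :=
  ⟨⟨NormedSpace.exp X.1, exp_mem_unitaryGroup (lieAlg_le_skewHermitian 𝒢 N X.2)⟩, by
    cases 𝒢 with
    | U => exact Subgroup.mem_top _
    | SU =>
      change (NormedSpace.exp X.1).det = 1
      rw [det_exp_of_skewHermitian X.2.1]
      have h1 := trace_re_eq_zero X.2.1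
      have h2 : X.1.trace.im = 0 := X.2.2
      rw [Complex.ext (z := X.1.trace) (w := 0) h1 h2, Complex.exp_zero]⟩

/-- The strict derivative of the exponential at `0` is the identity: this gives the Lipschitz error
`1 / 2` and, being onto, local surjectivity. -/
theorem exists_exp_approx (N : ℕ) {ε : ℝ} (hε : 0 < ε) : ∃ ρ : ℝ, 0 < ρ ∧ ρ ≤ ε ∧
    (∀ X ∈ Metric.ball (0 : Matrix (Fin N) (Fin N) ℂ) ρ, ∀ Y ∈ Metric.ball 0 ρ,
      ‖NormedSpace.exp X - NormedSpace.exp Y - (X - Y)‖ ≤ 1 / 2 * ‖X - Y‖) ∧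
    ∃ δ : ℝ, 0 < δ ∧ Metric.ball (1 : Matrix (Fin N) (Fin N) ℂ) δ ⊆
      NormedSpace.exp '' Metric.ball (0 : Matrix (Fin N) (Fin N) ℂ) (ρ / 2) := by
  have hc : CompleteSpace (Matrix (Fin N) (Fin N) ℂ) := FiniteDimensional.complete ℝ _
  have h := hasStrictFDerivAt_exp_zero (𝕂 := ℝ) (𝔸 := Matrix (Fin N) (Fin N) ℂ)
  obtain ⟨s, hs, hs'⟩ := h.approximates_deriv_on_nhds (c := 1 / 2) (Or.inr (by norm_num))
  obtain ⟨ρ', hρ', hρs'⟩ := Metric.mem_nhds_iff.1 hs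
  set ρ := min ρ' ε
  have hρ : 0 < ρ := lt_min hρ' hε
  have hρs := (Metric.ball_subset_ball (min_le_left ρ' ε)).trans hρs'
  refine ⟨ρ, hρ, min_le_right _ _, fun X hX Y hY => ?_, ?_⟩
  · have h1 := hs' X (hρs hX) Y (hρs hY)
    rwa [NNReal.coe_div, NNReal.coe_one, NNReal.coe_ofNat] at h1
  · have hm := h.map_nhds_eq_of_surj (by
      exact LinearMap.range_eq_top.2 fun x => ⟨x, rfl⟩)
    rw [NormedSpace.exp_zero] at hm
    have h1 : NormedSpace.exp '' Metric.ball (0 : Matrix (Fin N) (Fin N) ℂ) (ρ / 2) ∈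
        map NormedSpace.exp (𝓝 (0 : Matrix (Fin N) (Fin N) ℂ)) :=
      image_mem_map (Metric.ball_mem_nhds _ (by positivity))
    exact Metric.mem_nhds_iff.1 (hm.ge h1)

theorem continuous_expMap : Continuous (expMap 𝒢 N) := by
  have hc : CompleteSpace (Matrix (Fin N) (Fin N) ℂ) := FiniteDimensional.complete ℝ _
  have h : Continuous (NormedSpace.exp : Matrix (Fin N) (Fin N) ℂ → Matrix (Fin N) (Fin N) ℂ) :=
    NormedSpace.exp_continuous
  exact ((h.comp continuous_subtype_val).subtype_mk _).subtype_mk _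

theorem exists_isLocalChart (𝒢 : GaugeFamily) (N : ℕ) :
    ∃ ρ K δ : ℝ, IsLocalChart (expMap 𝒢 N) ρ K δ := by
  have htr : ContinuousAt (fun X : Matrix (Fin N) (Fin N) ℂ => X.trace) 0 :=
    (Continuous.matrix_trace continuous_id).continuousAt
  obtain ⟨ε, hε, hεtr⟩ := Metric.continuousAt_iff.1 htr 1 one_pos
  obtain ⟨ρ, hρ, hρε, happ, δ, hδ, hδs⟩ := exists_exp_approx N hε
  have hle : ∀ X ∈ Metric.ball (0 : Matrix (Fin N) (Fin N) ℂ) ρ, ∀ Y ∈ Metric.ball 0 ρ,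
      ‖X - Y‖ ≤ 2 * ‖NormedSpace.exp X - NormedSpace.exp Y‖ := fun X hX Y hY => by
    have h1 := happ X hX Y hY
    have h2 := norm_sub_norm_le (X - Y) (NormedSpace.exp X - NormedSpace.exp Y)
    rw [norm_sub_rev (X - Y)] at h2
    linarith
  -- The error `1 / 2` bounds the distortion between `1 / 2` and `3 / 2`, hence `K = 2`.
  refine ⟨ρ, 2, δ, continuous_expMap, hρ, two_pos, hδ, fun X hX Y hY => ?_, fun X hX Y hY => ?_,
    fun g hg => ?_⟩
  · rw [dist_group]
    rw [mem_ball_zero_iff] at hX hY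
    exact hle X.1 (mem_ball_zero_iff.2 hX) Y.1 (mem_ball_zero_iff.2 hY)
  · rw [dist_group]
    rw [mem_ball_zero_iff] at hX hY
    have h1 := happ X.1 (mem_ball_zero_iff.2 hX) Y.1 (mem_ball_zero_iff.2 hY)
    have h2 := norm_sub_norm_le (NormedSpace.exp X.1 - NormedSpace.exp Y.1) (X.1 - Y.1)
    have h3 : ‖X - Y‖ = ‖X.1 - Y.1‖ := rfl
    change ‖NormedSpace.exp X.1 - NormedSpace.exp Y.1‖ ≤ _
    rw [h3]
    linarith [norm_nonneg (X.1 - Y.1)]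
  · rw [Metric.mem_ball, dist_group] at hg
    obtain ⟨X, hX, hXg⟩ := hδs (mem_ball_iff_norm.2 hg)
    have hXρ : ‖X‖ < ρ := by
      rw [mem_ball_zero_iff] at hX
      linarith
    have hgg : (g.1.1).conjTranspose = (g.1.1)⁻¹ :=
      (Matrix.inv_eq_right_inv (Matrix.mem_unitaryGroup_iff.1 g.1.2)).symm
    -- `X†` and `-X` lie in the same ball and have the same exponential `g⁻¹`; the lower Lipschitz
    -- bound `hle` makes them equal.
    have hskew : X ∈ skewHermitian N := by
      rw [mem_skewHermitian, ← sub_eq_zero, ← norm_le_zero_iff]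
      refine (hle _ ?_ _ ?_).trans_eq ?_
      · rwa [mem_ball_zero_iff, Matrix.frobenius_norm_conjTranspose]
      · rwa [mem_ball_zero_iff, norm_neg]
      · rw [Matrix.exp_conjTranspose, Matrix.exp_neg, hXg, hgg, sub_self, norm_zero, mul_zero]
    have hlie : X ∈ lieAlg 𝒢 N := by
      cases 𝒢 with
      | U => exact hskew
      | SU =>
        refine ⟨hskew, ?_⟩
        have hdet : (NormedSpace.exp X).det = 1 := by rw [hXg]; exact g.2
        rw [det_exp_of_skewHermitian hskew, Complex.exp_eq_one_iff] at hdet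
        obtain ⟨n, hn⟩ := hdet
        have h1 : ‖X.trace‖ < 1 := by
          have := hεtr (x := X) (by rw [dist_zero_right]; linarith)
          rwa [Matrix.trace_zero, dist_zero_right] at this
        -- Determinant one only gives a trace in `2πiℤ`; `ε` was chosen to make the trace smaller
        -- than `1`, which leaves `0`.
        have h2 : (n : ℝ) = 0 := by
          rw [hn] at h1
          simp only [norm_mul, Complex.norm_intCast, Complex.norm_ofNat, Complex.norm_real,
            Complex.norm_I, mul_one, Real.norm_eq_abs, abs_of_pos Real.pi_pos] at h1
          by_contra hne
          have : (1 : ℝ) ≤ |(n : ℝ)| := by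
            rw [← Int.cast_abs]
            exact_mod_cast Int.one_le_abs (by exact_mod_cast hne)
          nlinarith [Real.pi_gt_three]
        change imTrace N X = 0
        rw [imTrace_apply, hn]
        have h3 : n = 0 := by exact_mod_cast h2
        simp [h3]
    exact ⟨⟨X, hlie⟩, mem_ball_zero_iff.2 (mem_ball_zero_iff.1 hX),
      Subtype.ext (Subtype.ext hXg)⟩

/-! ### Ball volumes and Gaussian integrals for Haar measure -/

instance : IsProbabilityMeasure (haarProb 𝒢 N) := ⟨Measure.haarMeasure_self⟩

theorem exists_haar_lintegral_exp_le (𝒢 : GaugeFamily) (N : ℕ) (hN : 1 ≤ N) :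
    ∃ C : ℝ, 0 < C ∧ ∀ β : ℝ, 0 < β →
      ∫⁻ g, ENNReal.ofReal (Real.exp (-(β * dist g 1 ^ 2))) ∂(haarProb 𝒢 N) ≤
        ENNReal.ofReal (C * (√β)⁻¹ ^ 𝒢.dim N) := by
  obtain ⟨ρ, K, δ, h⟩ := exists_isLocalChart 𝒢 N
  obtain ⟨C, hC, hC'⟩ := exists_measure_ball_le (haarProb 𝒢 N) h
  rw [finrank_lieAlg 𝒢 N hN] at hC'
  exact exists_lintegral_exp_le _ hC hC'

theorem exists_le_haar_ball (𝒢 : GaugeFamily) (N : ℕ) (hN : 1 ≤ N) {R : ℝ} (hR : 0 < R) :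
    ∃ c : ℝ, 0 < c ∧ ∀ r : ℝ, 0 < r → r ≤ R →
      ENNReal.ofReal (c * r ^ 𝒢.dim N) ≤ haarProb 𝒢 N (Metric.ball 1 r) := by
  obtain ⟨ρ, K, δ, h⟩ := exists_isLocalChart 𝒢 N
  obtain ⟨c, hc, hc'⟩ := exists_le_measure_ball (haarProb 𝒢 N) h hR
  rw [finrank_lieAlg 𝒢 N hN] at hc'
  exact ⟨c, hc, hc'⟩

end

/-! ### Integrating out the variables of a triangular product -/

/-- If the factor `h b` depends on the variable `b` and on variables of lower rank only, and its
integral over the variable `b` is the constant `C`, then the product integrates to a power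
of `C`. -/
theorem lintegral_prod_triangular {ι G α : Type*} [Fintype ι] [DecidableEq ι] [LinearOrder α]
    [MeasurableSpace G] (μ : Measure G) [IsProbabilityMeasure μ] (r : ι → α) (C : ENNReal)
    (h : ι → (ι → G) → ENNReal) (S : Finset ι) (hm : ∀ b ∈ S, Measurable (h b))
    (hdep : ∀ b ∈ S, ∀ c, c ≠ b → r b ≤ r c → ∀ u t, h b (Function.update u c t) = h b u)
    (hC : ∀ b ∈ S, ∀ u, ∫⁻ t, h b (Function.update u b t) ∂μ = C) :
    ∫⁻ u, ∏ b ∈ S, h b u ∂(Measure.pi fun _ => μ) = C ^ S.card := by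
  induction S using Finset.induction_on_max_value r with
  | empty => simp
  | insert a S ha hmax ih =>
    have hm' : ∀ b ∈ S, Measurable (h b) := fun b hb => hm b (Finset.mem_insert_of_mem hb)
    have ih' := ih hm' (fun b hb => hdep b (Finset.mem_insert_of_mem hb))
      (fun b hb => hC b (Finset.mem_insert_of_mem hb))
    obtain ⟨g₀⟩ := nonempty_of_isProbabilityMeasure μ
    have hupd : ∀ u t, ∏ b ∈ S, h b (Function.update u a t) = ∏ b ∈ S, h b u := fun u t =>
      Finset.prod_congr rfl fun b hb => hdep b (Finset.mem_insert_of_mem hb) a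
        (fun hab => ha (hab ▸ hb)) (hmax b hb) u t
    have hmS : Measurable fun u => ∏ b ∈ S, h b u := Finset.measurable_fun_prod S hm'
    have hmI : Measurable fun u => ∏ b ∈ insert a S, h b u := Finset.measurable_fun_prod _ hm
    -- Both integrals are written with the top variable `a` innermost. There the product over `S` is
    -- constant, and `h a` integrates to `C`. The base point `g₀` is arbitrary, as all variables are
    -- integrated.
    rw [lintegral_eq_lmarginal_univ (μ := fun _ => μ) (fun _ => g₀),
      lmarginal_erase' _ hmS (Finset.mem_univ a)] at ih'
    rw [lintegral_eq_lmarginal_univ (μ := fun _ => μ) (fun _ => g₀),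
      lmarginal_erase' _ hmI (Finset.mem_univ a), Finset.card_insert_of_notMem ha, pow_succ, ← ih']
    simp_rw [hupd]
    have h1 : (fun u => ∫⁻ t, ∏ b ∈ insert a S, h b (Function.update u a t) ∂μ) =
        fun u => (∏ b ∈ S, h b u) * C := by
      funext u
      have hma : Measurable fun t => h a (Function.update u a t) :=
        (hm a (Finset.mem_insert_self a S)).comp (measurable_update u)
      simp_rw [Finset.prod_insert ha, hupd]
      rw [lintegral_mul_const _ hma, hC a (Finset.mem_insert_self a S), mul_comm]
    rw [h1]
    simp only [lintegral_const, measure_univ, mul_one]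
    exact lintegral_mul_const _ (hmS.comp measurable_updateFinset)

/-! ### Combinatorics of the lattice -/

section Lattice

variable {d L : ℕ}

namespace Site

theorem succ_apply_self (x : Site d L) (μ : Fin d) (h : (x μ : ℕ) + 1 < L) :
    (x.succ μ h μ : ℕ) = x μ + 1 := by
  simp [Site.succ]

theorem sum_succ (x : Site d L) (μ : Fin d) (h : (x μ : ℕ) + 1 < L) :
    ∑ i, (x.succ μ h i : ℕ) = ∑ i, (x i : ℕ) + 1 := by
  rw [← Finset.add_sum_erase _ _ (Finset.mem_univ μ),
    ← Finset.add_sum_erase _ (fun i => (x i : ℕ)) (Finset.mem_univ μ), succ_apply_self]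
  have : ∑ i ∈ Finset.univ.erase μ, (x.succ μ h i : ℕ) = ∑ i ∈ Finset.univ.erase μ, (x i : ℕ) :=
    Finset.sum_congr rfl fun i hi => by rw [succ_of_ne x h (Finset.ne_of_mem_erase hi)]
  rw [this]
  ring

theorem succ_injective {x y : Site d L} {μ : Fin d} {hx : (x μ : ℕ) + 1 < L}
    {hy : (y μ : ℕ) + 1 < L} (h : x.succ μ hx = y.succ μ hy) : x = y := by
  funext i
  by_cases hi : i = μ
  · subst hi
    have := congrArg (fun z : Site d L => (z i : ℕ)) h
    simp only [succ_apply_self] at this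
    exact Fin.ext (by omega)
  · rw [← succ_of_ne x hx hi, h, succ_of_ne y hy hi]

theorem succ_comm (x : Site d L) {μ ν : Fin d} (hne : μ ≠ ν) (hμ : (x μ : ℕ) + 1 < L)
    (hν : (x ν : ℕ) + 1 < L) (hμ' : (x.succ ν hν μ : ℕ) + 1 < L)
    (hν' : (x.succ μ hμ ν : ℕ) + 1 < L) :
    (x.succ μ hμ).succ ν hν' = (x.succ ν hν).succ μ hμ' := by
  funext i
  apply Fin.ext
  by_cases h1 : i = μ
  · subst h1
    rw [succ_of_ne _ _ hne, succ_apply_self, succ_apply_self, succ_of_ne _ _ hne]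
  · by_cases h2 : i = ν
    · subst h2
      rw [succ_of_ne _ _ h1, succ_apply_self, succ_apply_self, succ_of_ne _ _ h1]
    · simp only [succ_of_ne _ _ h1, succ_of_ne _ _ h2]

/-- The neighbour `x - a e^μ`. -/
def pred (x : Site d L) (μ : Fin d) : Site d L :=
  Function.update x μ ⟨(x μ : ℕ) - 1, lt_of_le_of_lt (Nat.sub_le _ _) (x μ).2⟩

theorem pred_of_ne (x : Site d L) {μ ν : Fin d} (h : ν ≠ μ) : x.pred μ ν = x ν := by
  simp [pred, Function.update_of_ne h]

theorem pred_apply_self (x : Site d L) (μ : Fin d) : (x.pred μ μ : ℕ) = x μ - 1 := by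
  simp [pred]

theorem succ_pred (x : Site d L) {μ : Fin d} (hx : (x μ : ℕ) ≠ 0)
    (h : (x.pred μ μ : ℕ) + 1 < L) : (x.pred μ).succ μ h = x := by
  funext i
  apply Fin.ext
  by_cases hi : i = μ
  · subst hi
    rw [succ_apply_self, pred_apply_self]
    omega
  · rw [succ_of_ne _ _ hi, pred_of_ne _ hi]

end Site

namespace Bond

/-- The end point of a bond. -/
def tip (b : Bond d L) : Site d L := b.base.succ b.dir b.inside

theorem sum_tip (b : Bond d L) : ∑ i, (b.tip i : ℕ) = ∑ i, (b.base i : ℕ) + 1 :=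
  b.base.sum_succ b.dir b.inside

/-- The direction of a gauged-away bond is the first nonzero coordinate of its tip. At most one such
bond therefore ends at each site, which makes `treeGauge` path-independent. -/
theorem GaugedAway.eq_of_tip_eq {b c : Bond d L} (hb : b.GaugedAway) (hc : c.GaugedAway)
    (h : b.tip = c.tip) : b = c := by
  have aux : ∀ {b c : Bond d L}, c.GaugedAway → b.tip = c.tip → ¬ b.dir < c.dir := by
    intro b c hc h hlt
    have h1 := congrArg (fun z : Site d L => (z b.dir : ℕ)) h
    simp only [tip, Site.succ_apply_self, Site.succ_of_ne _ _ hlt.ne, hc _ hlt] at h1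
    omega
  have hdir : b.dir = c.dir := le_antisymm (not_lt.1 (aux hb h.symm)) (not_lt.1 (aux hc h))
  obtain ⟨x, μ, hx⟩ := b
  obtain ⟨y, ν, hy⟩ := c
  obtain rfl : μ = ν := hdir
  obtain rfl : x = y := Site.succ_injective h
  rfl

/-- The order in which bonds are integrated out, by direction and then by height. -/
def rank (b : Bond d L) : Fin d ×ₗ ℕ := toLex (b.dir, ∑ i, (b.base i : ℕ))

end Bond

namespace Plaquette

/-- `bond₂` is the strict maximum of its plaquette: it beats `bond₁` and `bond₃` by direction, and
the parallel `bond₄` by height. -/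
theorem rank_bond₁_lt (p : Plaquette d L) : p.bond₁.rank < p.bond₂.rank :=
  Prod.Lex.toLex_lt_toLex.2 (Or.inl p.lt)

theorem rank_bond₃_lt (p : Plaquette d L) : p.bond₃.rank < p.bond₂.rank :=
  Prod.Lex.toLex_lt_toLex.2 (Or.inl p.lt)

theorem rank_bond₄_lt (p : Plaquette d L) : p.bond₄.rank < p.bond₂.rank :=
  Prod.Lex.toLex_lt_toLex.2 (Or.inr ⟨rfl, by
    change ∑ i, (p.base i : ℕ) < ∑ i, (p.base.succ p.μ p.inside_μ i : ℕ)
    rw [Site.sum_succ]; exact Nat.lt_succ_self _⟩)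

theorem not_gaugedAway_bond₂ (p : Plaquette d L) : ¬ p.bond₂.GaugedAway := by
  intro h
  have h1 : (p.base.succ p.μ p.inside_μ p.μ : ℕ) = 0 := h p.μ p.lt
  rw [Site.succ_apply_self] at h1
  omega

theorem bond₂_injective {p q : Plaquette d L} (h : p.bond₂ = q.bond₂) (hμ : p.μ = q.μ) :
    p = q := by
  obtain ⟨x, μ, ν, hlt, h1, h2⟩ := p
  obtain ⟨y, μ', ν', hlt', h1', h2'⟩ := q
  obtain rfl : μ = μ' := hμ
  obtain rfl : ν = ν' := congrArg Bond.dir h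
  obtain rfl : x = y := Site.succ_injective (congrArg Bond.base h)
  rfl

end Plaquette

/-- A retained bond has a nonzero coordinate `μ` before its direction; the plaquette is found by
stepping back once along `μ`. -/
theorem Bond.exists_bond₂_eq {b : Bond d L} (hb : ¬ b.GaugedAway) :
    ∃ p : Plaquette d L, p.bond₂ = b := by
  simp only [Bond.GaugedAway, not_forall] at hb
  obtain ⟨μ, hμ, h0⟩ := hb
  have h1 : (b.base.pred μ μ : ℕ) + 1 < L := by
    rw [Site.pred_apply_self]
    have := (b.base μ).2
    omega
  refine ⟨⟨b.base.pred μ, μ, b.dir, hμ, h1, by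
    rw [Site.pred_of_ne _ hμ.ne']; exact b.inside⟩, ?_⟩
  obtain ⟨x, ν, hx⟩ := b
  simp only [Plaquette.bond₂, Bond.mk.injEq, and_true]
  exact Site.succ_pred x h0 h1

open Classical in
/-- The retained bonds as a finite set. -/
def retainedBonds (d L : ℕ) : Finset (Bond d L) := Finset.univ.filter fun b => ¬ b.GaugedAway

theorem mem_retainedBonds {b : Bond d L} : b ∈ retainedBonds d L ↔ ¬ b.GaugedAway := by
  simp [retainedBonds]

theorem card_retainedBonds : (retainedBonds d L).card = retained d L := by
  classical
  rw [retained, Nat.card_eq_fintype_card, Fintype.card_subtype, retainedBonds]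

/-- A plaquette is determined by its top bond, which is retained, together with the direction `μ`.
-/
theorem card_plaquette_le : Fintype.card (Plaquette d L) ≤ retained d L * d := by
  classical
  have h : Fintype.card (Plaquette d L) ≤
      Fintype.card ({b : Bond d L // ¬ b.GaugedAway} × Fin d) :=
    Fintype.card_le_of_injective (fun p => (⟨p.bond₂, p.not_gaugedAway_bond₂⟩, p.μ))
      fun p q hpq => Plaquette.bond₂_injective
        (congrArg (fun z => (z.1 : Bond d L)) hpq) (congrArg Prod.snd hpq)
  rw [retained, Nat.card_eq_fintype_card]
  rwa [Fintype.card_prod, Fintype.card_fin] at h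

theorem retained_pos (hd : 2 ≤ d) (hL : 2 ≤ L) : 0 < retained d L := by
  let p : Plaquette d L := ⟨fun _ => ⟨0, by omega⟩, ⟨0, by omega⟩, ⟨1, by omega⟩,
    Fin.mk_lt_mk.2 one_pos, hL, hL⟩
  rw [← card_retainedBonds]
  exact Finset.card_pos.2 ⟨p.bond₂, mem_retainedBonds.2 p.not_gaugedAway_bond₂⟩

/-! ### Gauge fixing -/

open Classical in
/-- The parallel transport from the origin to `x` along the tree of bonds that are gauged away. -/
def treeGauge {G : Type*} [Group G] (u : Bond d L → G) (x : Site d L) : G :=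
  if h : ∃ b : Bond d L, b.GaugedAway ∧ b.tip = x then
    treeGauge u h.choose.base * u h.choose
  else 1
termination_by ∑ i, (x i : ℕ)
decreasing_by
  have h1 := h.choose.sum_tip
  rw [h.choose_spec.2] at h1
  exact h1 ▸ Nat.lt_succ_self _

section Gauge

variable {G : Type*} [Group G]

theorem treeGauge_tip (u : Bond d L → G) {b : Bond d L} (hb : b.GaugedAway) :
    treeGauge u b.tip = treeGauge u b.base * u b := by
  have h : ∃ c : Bond d L, c.GaugedAway ∧ c.tip = b.tip := ⟨b, hb, rfl⟩
  have hc : h.choose = b := h.choose_spec.1.eq_of_tip_eq hb h.choose_spec.2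
  rw [treeGauge, dif_pos h, hc]

theorem treeGauge_eq_one (u : Bond d L → G) {x : Site d L}
    (h : ¬ ∃ b : Bond d L, b.GaugedAway ∧ b.tip = x) : treeGauge u x = 1 := by
  rw [treeGauge, dif_neg h]

theorem Site.tree_induction {motive : Site d L → Prop}
    (root : ∀ x, (¬ ∃ b : Bond d L, b.GaugedAway ∧ b.tip = x) → motive x)
    (step : ∀ b : Bond d L, b.GaugedAway → motive b.base → motive b.tip) (x : Site d L) :
    motive x := by
  induction hn : ∑ i, (x i : ℕ) using Nat.strong_induction_on generalizing x with
  | _ n ih =>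
    by_cases h : ∃ b : Bond d L, b.GaugedAway ∧ b.tip = x
    · obtain ⟨b, hb, rfl⟩ := h
      refine step b hb (ih _ ?_ b.base rfl)
      rw [← hn, Bond.sum_tip]
      exact Nat.lt_succ_self _
    · exact root x h

/-- Transport uses tree bonds only. Hence, as a function of one retained variable, `gaugeFix` is a
two-sided translation of that variable. -/
theorem treeGauge_update [DecidableEq (Bond d L)] (u : Bond d L → G) {c : Bond d L}
    (hc : ¬ c.GaugedAway) (t : G) (x : Site d L) :
    treeGauge (Function.update u c t) x = treeGauge u x := by
  induction x using Site.tree_induction with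
  | root x h => rw [treeGauge_eq_one _ h, treeGauge_eq_one _ h]
  | step b hb ih =>
    rw [treeGauge_tip _ hb, treeGauge_tip _ hb, ih, Function.update_of_ne]
    rintro rfl
    exact hc hb

theorem continuous_treeGauge [TopologicalSpace G] [IsTopologicalGroup G] (x : Site d L) :
    Continuous fun u : Bond d L → G => treeGauge u x := by
  induction x using Site.tree_induction with
  | root x h => simp_rw [treeGauge_eq_one _ h]; exact continuous_const
  | step b hb ih =>
    simp_rw [treeGauge_tip _ hb]
    exact ih.mul (continuous_apply b)

/-- The gauge transform of `u` that is trivial on the bonds that are gauged away. -/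
def gaugeFix (u : Bond d L → G) (b : Bond d L) : G :=
  treeGauge u b.base * u b * (treeGauge u b.tip)⁻¹

theorem gaugeFix_of_gaugedAway (u : Bond d L → G) {b : Bond d L} (hb : b.GaugedAway) :
    gaugeFix u b = 1 := by
  rw [gaugeFix, treeGauge_tip u hb, mul_inv_cancel]

theorem continuous_gaugeFix [TopologicalSpace G] [IsTopologicalGroup G] (b : Bond d L) :
    Continuous fun u : Bond d L → G => gaugeFix u b :=
  ((continuous_treeGauge _).mul (continuous_apply b)).mul (continuous_treeGauge _).inv

end Gauge

end Lattice

/-! ### Gauge invariance of the action and bounds on the partition function -/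

variable {𝒢 : GaugeFamily} {N d L : ℕ}

theorem dist_mul_one_le (g h : 𝒢.group N) : dist (g * h) 1 ≤ dist g 1 + dist h 1 := by
  have h1 := dist_triangle (g * h) g 1
  have h2 : dist (g * h) g = dist h 1 := by
    conv_lhs => rw [← mul_one g, mul_assoc, one_mul]
    exact dist_mul_left_group _ _ _
  linarith

theorem dist_inv_one (g : 𝒢.group N) : dist g⁻¹ 1 = dist g 1 := by
  rw [← dist_mul_left_group g⁻¹ 1 g, mul_inv_cancel, mul_one, dist_comm]

theorem dist_conj_one (g h : 𝒢.group N) : dist (h * g * h⁻¹) 1 = dist g 1 := by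
  rw [← dist_mul_right_group (h * g * h⁻¹) 1 h, inv_mul_cancel_right, one_mul]
  conv_lhs => rw [← mul_one h, mul_assoc, one_mul]
  exact dist_mul_left_group _ _ _

theorem plaquetteAction_eq (u : Bond d L → 𝒢.group N) (p : Plaquette d L) :
    plaquetteAction u p = dist (plaquetteVar u p) 1 ^ 2 := by
  rw [plaquetteAction, hsNormSq_eq_norm_sq, dist_comm, dist_group]
  rfl

theorem plaquetteAction_nonneg (u : Bond d L → 𝒢.group N) (p : Plaquette d L) :
    0 ≤ plaquetteAction u p := by
  rw [plaquetteAction_eq]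
  positivity

theorem continuous_plaquetteVar (p : Plaquette d L) :
    Continuous fun u : Bond d L → 𝒢.group N => plaquetteVar u p :=
  (((continuous_apply p.bond₁).mul (continuous_apply p.bond₂)).mul
    (continuous_apply p.bond₃).inv).mul (continuous_apply p.bond₄).inv

theorem continuous_plaquetteAction (p : Plaquette d L) :
    Continuous fun u : Bond d L → 𝒢.group N => plaquetteAction u p := by
  simp_rw [plaquetteAction_eq]
  exact ((continuous_plaquetteVar p).dist continuous_const).pow 2

theorem plaquetteVar_gaugeFix (u : Bond d L → 𝒢.group N) (p : Plaquette d L) :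
    plaquetteVar (gaugeFix u) p =
      treeGauge u p.base * plaquetteVar u p * (treeGauge u p.base)⁻¹ := by
  have h1 : p.bond₁.tip = p.bond₂.base := rfl
  have h2 : p.bond₄.tip = p.bond₃.base := rfl
  have h3 : p.bond₂.tip = p.bond₃.tip :=
    p.base.succ_comm p.lt.ne p.inside_μ p.inside_ν p.bond₃.inside p.bond₂.inside
  have h4 : p.bond₁.base = p.base := rfl
  have h5 : p.bond₄.base = p.base := rfl
  simp only [plaquetteVar, gaugeFix, h1, h2, h3, h4, h5]
  group

/-- Gauge fixing conjugates the plaquette variable and so preserves its distance to `1`; the four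
edges then add up by the triangle inequality. -/
theorem plaquetteAction_le (u : Bond d L → 𝒢.group N) {r : ℝ}
    (h : ∀ b, dist (gaugeFix u b) 1 ≤ r) (p : Plaquette d L) :
    plaquetteAction u p ≤ (4 * r) ^ 2 := by
  rw [plaquetteAction_eq, ← dist_conj_one _ (treeGauge u p.base), ← plaquetteVar_gaugeFix,
    plaquetteVar]
  have h1 := dist_mul_one_le (gaugeFix u p.bond₁ * gaugeFix u p.bond₂ * (gaugeFix u p.bond₃)⁻¹)
    (gaugeFix u p.bond₄)⁻¹
  have h2 := dist_mul_one_le (gaugeFix u p.bond₁ * gaugeFix u p.bond₂) (gaugeFix u p.bond₃)⁻¹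
  have h3 := dist_mul_one_le (gaugeFix u p.bond₁) (gaugeFix u p.bond₂)
  rw [dist_inv_one] at h1 h2
  have := h p.bond₁
  have := h p.bond₂
  have := h p.bond₃
  have := h p.bond₄
  exact pow_le_pow_left₀ dist_nonneg (by linarith) 2

theorem ofReal_partitionFn (𝒢 : GaugeFamily) (N d L : ℕ) (a g : ℝ) (hβ : 0 ≤ coupling d a g) :
    ENNReal.ofReal (partitionFn 𝒢 N d L a g) = ∫⁻ u : Bond d L → 𝒢.group N,
      ENNReal.ofReal (Real.exp (-(coupling d a g * ∑ p : Plaquette d L, plaquetteAction u p)))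
      ∂(Measure.pi fun _ => haarProb 𝒢 N) := by
  have hc : Continuous fun u : Bond d L → 𝒢.group N =>
      Real.exp (-(coupling d a g * ∑ p : Plaquette d L, plaquetteAction u p)) :=
    Real.continuous_exp.comp (continuous_const.mul
      (continuous_finsetSum _ fun p _ => continuous_plaquetteAction p)).neg
  refine ofReal_integral_eq_lintegral_ofReal ?_ (Eventually.of_forall fun u => Real.exp_nonneg _)
  refine Integrable.of_bound hc.measurable.aestronglyMeasurable 1 (Eventually.of_forall fun u => ?_)
  rw [Real.norm_eq_abs, Real.abs_exp, Real.exp_le_one_iff, neg_nonpos]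
  exact mul_nonneg hβ (Finset.sum_nonneg fun p _ => plaquetteAction_nonneg u p)

/-- Translation invariance of the one-plaquette integral. -/
theorem lintegral_dist_mul (f : ℝ → ENNReal) (g h : 𝒢.group N) :
    ∫⁻ t, f (dist (g * t * h) 1) ∂(haarProb 𝒢 N) = ∫⁻ t, f (dist t 1) ∂(haarProb 𝒢 N) := by
  -- Conjugating by `h` turns `g * t * h` into `h * g * t`, so left invariance suffices.
  rw [← lintegral_mul_left_eq_self (fun t => f (dist t 1)) (h * g)]
  refine lintegral_congr fun t => ?_
  rw [← dist_conj_one (g * t * h) h]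
  congr 2
  group

theorem lintegral_action_le (𝒢 : GaugeFamily) (N d L : ℕ) {β : ℝ} (hβ : 0 ≤ β) :
    ∫⁻ u : Bond d L → 𝒢.group N,
      ENNReal.ofReal (Real.exp (-(β * ∑ p : Plaquette d L, plaquetteAction u p)))
      ∂(Measure.pi fun _ => haarProb 𝒢 N) ≤
    (∫⁻ t, ENNReal.ofReal (Real.exp (-(β * dist t 1 ^ 2))) ∂(haarProb 𝒢 N)) ^ retained d L := by
  classical
  -- `choose!` needs a default plaquette; without plaquettes there are no retained bonds and both
  -- sides are `1`.
  rcases isEmpty_or_nonempty (Plaquette d L) with hP | hP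
  · have h0 : retainedBonds d L = ∅ := Finset.eq_empty_of_forall_notMem fun b hb =>
      (Bond.exists_bond₂_eq (mem_retainedBonds.1 hb)).elim fun p _ => hP.false p
    rw [← card_retainedBonds, h0]
    simp
  choose! P hP using fun (b : Bond d L) (hb : ¬ b.GaugedAway) => Bond.exists_bond₂_eq hb
  have hPS : ∀ b ∈ retainedBonds d L, (P b).bond₂ = b := fun b hb => hP b (mem_retainedBonds.1 hb)
  let h : Bond d L → (Bond d L → 𝒢.group N) → ENNReal := fun b u =>
    ENNReal.ofReal (Real.exp (-(β * dist (plaquetteVar u (P b)) 1 ^ 2)))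
  rw [← card_retainedBonds, ← lintegral_prod_triangular (haarProb 𝒢 N) Bond.rank
    (∫⁻ t, ENNReal.ofReal (Real.exp (-(β * dist t 1 ^ 2))) ∂(haarProb 𝒢 N)) h]
  · refine lintegral_mono fun u => ?_
    rw [← ENNReal.ofReal_prod_of_nonneg fun _ _ => Real.exp_nonneg _, ← Real.exp_sum]
    refine ENNReal.ofReal_le_ofReal (Real.exp_le_exp.2 ?_)
    rw [Finset.sum_neg_distrib, ← Finset.mul_sum]
    refine neg_le_neg (mul_le_mul_of_nonneg_left ?_ hβ)
    have hinj : Set.InjOn P (retainedBonds d L) := fun b hb c hc hbc => by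
      rw [← hPS b hb, hbc, hPS c hc]
    rw [← Finset.sum_image (f := fun p => dist (plaquetteVar u p) 1 ^ 2) hinj]
    simp_rw [← plaquetteAction_eq]
    exact Finset.sum_le_sum_of_subset_of_nonneg (Finset.subset_univ _)
      fun p _ _ => plaquetteAction_nonneg u p
  · intro b _
    refine Continuous.measurable (ENNReal.continuous_ofReal.comp (Real.continuous_exp.comp ?_))
    exact (continuous_const.mul
      (((continuous_plaquetteVar (P b)).dist continuous_const).pow 2)).neg
  · intro b hb c hcb hr u t
    have hr' : (P b).bond₂.rank ≤ c.rank := by rwa [hPS b hb]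
    have h1 : (P b).bond₁ ≠ c := fun e => absurd (P b).rank_bond₁_lt (by rw [e]; exact hr'.not_gt)
    have h2 : (P b).bond₂ ≠ c := by rw [hPS b hb]; exact hcb.symm
    have h3 : (P b).bond₃ ≠ c := fun e => absurd (P b).rank_bond₃_lt (by rw [e]; exact hr'.not_gt)
    have h4 : (P b).bond₄ ≠ c := fun e => absurd (P b).rank_bond₄_lt (by rw [e]; exact hr'.not_gt)
    simp only [h, plaquetteVar, Function.update_of_ne h1, Function.update_of_ne h2,
      Function.update_of_ne h3, Function.update_of_ne h4]
  · intro b hb u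
    have h1 : (P b).bond₁ ≠ (P b).bond₂ := fun e =>
      absurd (P b).rank_bond₁_lt (by rw [e]; exact lt_irrefl _)
    have h3 : (P b).bond₃ ≠ (P b).bond₂ := fun e =>
      absurd (P b).rank_bond₃_lt (by rw [e]; exact lt_irrefl _)
    have h4 : (P b).bond₄ ≠ (P b).bond₂ := fun e =>
      absurd (P b).rank_bond₄_lt (by rw [e]; exact lt_irrefl _)
    rw [← lintegral_dist_mul (fun x => ENNReal.ofReal (Real.exp (-(β * x ^ 2))))
      (u (P b).bond₁) ((u (P b).bond₃)⁻¹ * (u (P b).bond₄)⁻¹)]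
    refine lintegral_congr fun t => ?_
    have e : plaquetteVar (Function.update u b t) (P b) =
        u (P b).bond₁ * t * ((u (P b).bond₃)⁻¹ * (u (P b).bond₄)⁻¹) := by
      rw [show Function.update u b t = Function.update u (P b).bond₂ t by rw [hPS b hb]]
      simp only [plaquetteVar, Function.update_of_ne h1, Function.update_self,
        Function.update_of_ne h3, Function.update_of_ne h4, mul_assoc]
    simp only [h, e]

theorem le_lintegral_action (𝒢 : GaugeFamily) (N d L : ℕ) {β r : ℝ} (hβ : 0 ≤ β) (hr : 0 < r) :
    ENNReal.ofReal (Real.exp (-(β * (4 * r) ^ 2 * d * retained d L))) *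
      haarProb 𝒢 N (Metric.ball 1 r) ^ retained d L ≤
    ∫⁻ u : Bond d L → 𝒢.group N,
      ENNReal.ofReal (Real.exp (-(β * ∑ p : Plaquette d L, plaquetteAction u p)))
      ∂(Measure.pi fun _ => haarProb 𝒢 N) := by
  classical
  let f : ℝ → ENNReal := (Set.Iio r).indicator 1
  have hf : Measurable f := measurable_one.indicator measurableSet_Iio
  let h : Bond d L → (Bond d L → 𝒢.group N) → ENNReal := fun b u => f (dist (gaugeFix u b) 1)
  have hm : ∀ b, Measurable (h b) := fun b =>
    hf.comp ((continuous_gaugeFix b).dist continuous_const).measurable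
  have hV : haarProb 𝒢 N (Metric.ball 1 r) = ∫⁻ t, f (dist t 1) ∂(haarProb 𝒢 N) := by
    rw [← lintegral_indicator_one measurableSet_ball]
    rfl
  rw [← card_retainedBonds, hV, ← lintegral_prod_triangular (haarProb 𝒢 N)
    -- Two ranks suffice: a gauge-fixed retained variable depends on itself and on tree variables,
    -- never on another retained bond.
    (fun b : Bond d L => if b.GaugedAway then 0 else 1)
    (∫⁻ t, f (dist t 1) ∂(haarProb 𝒢 N)) h (retainedBonds d L) (fun b _ => hm b),
    ← lintegral_const_mul _ (Finset.measurable_fun_prod _ fun b _ => hm b)]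
  · refine lintegral_mono fun u => ?_
    by_cases hu : ∀ b ∈ retainedBonds d L, dist (gaugeFix u b) 1 < r
    · have h1 : ∏ b ∈ retainedBonds d L, h b u = 1 :=
        Finset.prod_eq_one fun b hb => Set.indicator_of_mem (s := Set.Iio r) (hu b hb) _
      rw [h1, mul_one]
      refine ENNReal.ofReal_le_ofReal (Real.exp_le_exp.2 (neg_le_neg ?_))
      have h2 : ∀ b, dist (gaugeFix u b) 1 ≤ r := fun b => by
        by_cases hb : b.GaugedAway
        · rw [gaugeFix_of_gaugedAway u hb, dist_self]; exact hr.le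
        · exact (hu b (mem_retainedBonds.2 hb)).le
      have h3 : ∑ p : Plaquette d L, plaquetteAction u p ≤ retained d L * d * (4 * r) ^ 2 := by
        refine (Finset.sum_le_card_nsmul _ _ _ fun p _ => plaquetteAction_le u h2 p).trans ?_
        rw [nsmul_eq_mul]
        refine mul_le_mul_of_nonneg_right ?_ (by positivity)
        exact_mod_cast card_plaquette_le
      rw [card_retainedBonds]
      calc _ ≤ β * (retained d L * d * (4 * r) ^ 2) := mul_le_mul_of_nonneg_left h3 hβ
        _ = _ := by ring
    · push Not at hu
      obtain ⟨b, hb, hbr⟩ := hu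
      have h1 : h b u = 0 := Set.indicator_of_notMem (s := Set.Iio r) (not_lt.2 hbr) _
      rw [Finset.prod_eq_zero hb h1, mul_zero]
      exact zero_le
  · intro b hb c hcb hrk u t
    have hb' := mem_retainedBonds.1 hb
    have hc : ¬ c.GaugedAway := fun hc => by simp [hb', hc] at hrk
    simp only [h, gaugeFix, treeGauge_update u hc, Function.update_of_ne hcb.symm]
  · intro b hb u
    have hb' := mem_retainedBonds.1 hb
    rw [← lintegral_dist_mul f (treeGauge u b.base) (treeGauge u b.tip)⁻¹]
    simp only [h, gaugeFix, treeGauge_update u hb', Function.update_self]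

/-- This is where `d ≤ 4`, `a ≤ 1` and `g² ≤ g₀²` enter: they keep the radius `β ^ (-1/2)` below
`g₀`, where the lower volume bound is uniform. -/
theorem coupling_ge {d : ℕ} (hd : d ≤ 4) {a g g₀ : ℝ} (ha : a ∈ Set.Ioc (0 : ℝ) 1)
    (hg : g ^ 2 ∈ Set.Ioc 0 (g₀ ^ 2)) : 1 / g₀ ^ 2 ≤ coupling d a g := by
  rw [coupling]
  have h1 : 1 ≤ a ^ ((d : ℤ) - 4) :=
    one_le_zpow_of_nonpos₀ ha.1 ha.2 (by omega)
  exact div_le_div₀ (by linarith) h1 hg.1 hg.2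

theorem coupling_rpow {β : ℝ} (hβ : 0 ≤ β) (D R : ℕ) :
    β ^ (((D : ℝ) * (R : ℝ)) / 2) = ((√β) ^ D) ^ R := by
  rw [← pow_mul, Real.sqrt_eq_rpow, ← Real.rpow_natCast, ← Real.rpow_mul hβ]
  push_cast
  ring_nf

theorem exists_stability_bounds (𝒢 : GaugeFamily) (N : ℕ) (hN : 1 ≤ N)
    (hD : 0 < 𝒢.dim N) (d : ℕ) (hd : d ≤ 4) (g₀ : ℝ) (hg₀ : 0 < g₀) :
    ∃ cl cu : ℝ, ∀ L : ℕ, ∀ a ∈ Set.Ioc (0 : ℝ) 1, ∀ g : ℝ, g ^ 2 ∈ Set.Ioc 0 (g₀ ^ 2) →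
      Real.exp (cl * (𝒢.dim N : ℝ) * (retained d L : ℝ)) ≤ normPartitionFn 𝒢 N d L a g ∧
      normPartitionFn 𝒢 N d L a g ≤ Real.exp (cu * (𝒢.dim N : ℝ) * (retained d L : ℝ)) := by
  obtain ⟨C, hC, hCb⟩ := exists_haar_lintegral_exp_le 𝒢 N hN
  obtain ⟨c, hc, hcb⟩ := exists_le_haar_ball 𝒢 N hN hg₀
  have hD' : (𝒢.dim N : ℝ) ≠ 0 := by positivity
  -- `c` and `C` are the ball-volume and Gaussian constants; `16 * d` is the cost per retained bond
  -- at `r = β ^ (-1/2)`, where `β * (4 * r) ^ 2 = 16`.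
  refine ⟨(Real.log c - 16 * d) / 𝒢.dim N, Real.log C / 𝒢.dim N, fun L a ha g hg => ?_⟩
  set β := coupling d a g with hβdef
  have hβ₀ : 1 / g₀ ^ 2 ≤ β := coupling_ge hd ha hg
  have hβ : 0 < β := lt_of_lt_of_le (by positivity) hβ₀
  have hs : 0 < √β := Real.sqrt_pos.2 hβ
  have hZ := ofReal_partitionFn 𝒢 N d L a g hβ.le
  have hZ0 : 0 ≤ partitionFn 𝒢 N d L a g := integral_nonneg fun u => Real.exp_nonneg _
  rw [normPartitionFn, ← hβdef, coupling_rpow hβ.le, div_mul_cancel₀ _ hD',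
    div_mul_cancel₀ _ hD']
  have hcancel : (√β) ^ 𝒢.dim N * (√β)⁻¹ ^ 𝒢.dim N = 1 := by
    rw [← mul_pow, mul_inv_cancel₀ hs.ne', one_pow]
  constructor
  · have hr : (√β)⁻¹ ≤ g₀ := by
      rw [inv_le_comm₀ hs hg₀]
      refine Real.le_sqrt_of_sq_le ?_
      rwa [inv_pow, ← one_div]
    have h1 := le_lintegral_action 𝒢 N d L hβ.le (inv_pos.2 hs)
    rw [← hZ] at h1
    have h2 : ENNReal.ofReal (Real.exp (-(β * (4 * (√β)⁻¹) ^ 2 * d * retained d L)) *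
        (c * (√β)⁻¹ ^ 𝒢.dim N) ^ retained d L) ≤ ENNReal.ofReal (partitionFn 𝒢 N d L a g) := by
      refine le_trans ?_ h1
      rw [ENNReal.ofReal_mul (Real.exp_nonneg _), ENNReal.ofReal_pow (by positivity)]
      gcongr
      exact hcb _ (inv_pos.2 hs) hr
    rw [ENNReal.ofReal_le_ofReal_iff hZ0] at h2
    refine le_trans (le_of_eq ?_) (mul_le_mul_of_nonneg_left h2 (by positivity))
    have h3 : β * (4 * (√β)⁻¹) ^ 2 = 16 := by
      rw [mul_pow, inv_pow, Real.sq_sqrt hβ.le]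
      field_simp
      norm_num
    have h4 : Real.exp ((Real.log c - 16 * d) * retained d L) =
        c ^ retained d L * Real.exp (-(16 * d * retained d L)) := by
      conv_rhs => rw [← Real.exp_log hc, ← Real.exp_nat_mul, ← Real.exp_add]
      congr 1
      ring
    rw [h3, h4, mul_pow c]
    calc _ = c ^ retained d L * Real.exp (-(16 * d * retained d L)) *
          (√β ^ 𝒢.dim N * (√β)⁻¹ ^ 𝒢.dim N) ^ retained d L := by rw [hcancel, one_pow, mul_one]
      _ = _ := by rw [mul_pow]; ring
  · have h1 := lintegral_action_le 𝒢 N d L hβ.le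
    rw [← hZ] at h1
    have h2 : ENNReal.ofReal (partitionFn 𝒢 N d L a g) ≤
        ENNReal.ofReal ((C * (√β)⁻¹ ^ 𝒢.dim N) ^ retained d L) := by
      rw [ENNReal.ofReal_pow (by positivity)]
      exact h1.trans (pow_le_pow_left' (hCb β hβ) _)
    rw [ENNReal.ofReal_le_ofReal_iff (by positivity)] at h2
    refine (mul_le_mul_of_nonneg_left h2 (by positivity)).trans_eq ?_
    rw [← mul_pow, mul_left_comm, hcancel, mul_one]
    conv_lhs => rw [← Real.exp_log hC, ← Real.exp_nat_mul]
    rw [mul_comm]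

theorem dim_pos (𝒢 : GaugeFamily) (N : ℕ) (hN : 1 ≤ N) (hSU : 𝒢 = .SU → 2 ≤ N) :
    0 < 𝒢.dim N := by
  cases 𝒢 with
  | U => exact pow_pos hN 2
  | SU =>
    have := hSU rfl
    have : 1 < N ^ 2 := by nlinarith
    exact Nat.sub_pos_of_lt this

theorem freeEnergy_eq {𝒢 : GaugeFamily} {N d L : ℕ} {a g : ℝ} (hβ : 0 < coupling d a g)
    (hZ : 0 < normPartitionFn 𝒢 N d L a g) (hD : 0 < 𝒢.dim N) (hR : 0 < retained d L) :
    freeEnergy 𝒢 N d L a g =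
      -(1 / 2) * Real.log (coupling d a g) + normFreeEnergy 𝒢 N d L a g := by
  have hpow : 0 < coupling d a g ^ (((𝒢.dim N : ℝ) * (retained d L : ℝ)) / 2) :=
    Real.rpow_pos_of_pos hβ _
  have hZ' : 0 < partitionFn 𝒢 N d L a g := by
    rw [normPartitionFn] at hZ
    exact (pos_iff_pos_of_mul_pos hZ).1 hpow
  rw [freeEnergy, normFreeEnergy, normPartitionFn, Real.log_mul hpow.ne' hZ'.ne',
    Real.log_rpow hβ]
  field_simp
  ring

end LatticeYM

theorem theorem1 (𝒢 : LatticeYM.GaugeFamily) (N : ℕ) (hN : 1 ≤ N)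
    (hSU : 𝒢 = LatticeYM.GaugeFamily.SU → 2 ≤ N)
    (d : ℕ) (hd : d = 2 ∨ d = 3 ∨ d = 4) (g₀ : ℝ) (hg₀ : 0 < g₀) :
    ∃ cl cu : ℝ,
      -- stability bounds, with constants independent of the lattice, of `a` and of `g²`
      (∀ L : ℕ, 1 ≤ L → ∀ a ∈ Set.Ioc (0 : ℝ) 1, ∀ g : ℝ, g ^ 2 ∈ Set.Ioc 0 (g₀ ^ 2) →
        Real.exp (cl * (LatticeYM.GaugeFamily.dim 𝒢 N : ℝ) * (LatticeYM.retained d L : ℝ)) ≤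
            LatticeYM.normPartitionFn 𝒢 N d L a g ∧
        LatticeYM.normPartitionFn 𝒢 N d L a g ≤
          Real.exp (cu * (LatticeYM.GaugeFamily.dim 𝒢 N : ℝ) * (LatticeYM.retained d L : ℝ))) ∧
      -- the singular part of the finite-lattice free energy is isolated
      (∀ L : ℕ, 2 ≤ L → ∀ a ∈ Set.Ioc (0 : ℝ) 1, ∀ g : ℝ, g ^ 2 ∈ Set.Ioc 0 (g₀ ^ 2) →
        LatticeYM.freeEnergy 𝒢 N d L a g =
            -(1 / 2) * Real.log (LatticeYM.coupling d a g) + LatticeYM.normFreeEnergy 𝒢 N d L a g ∧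
        LatticeYM.normFreeEnergy 𝒢 N d L a g ∈ Set.Icc cl cu) ∧
      -- subsequential thermodynamic limits: every sequence of lattices growing to `aℤ^d` has a
      -- subsequence along which the normalized free energy converges to a finite limit
      (∀ a ∈ Set.Ioc (0 : ℝ) 1, ∀ g : ℝ, g ^ 2 ∈ Set.Ioc 0 (g₀ ^ 2) →
        ∀ L : ℕ → ℕ, Tendsto L atTop atTop →
          ∃ φ : ℕ → ℕ, StrictMono φ ∧ ∃ f : ℝ,
            Tendsto (fun j => LatticeYM.normFreeEnergy 𝒢 N d (L (φ j)) a g) atTop (𝓝 f)) ∧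
      -- subsequential continuum limits: for spacings tending to `0` and any choice of
      -- subsequential thermodynamic limits at these spacings, a subsequence of these converges
      -- to a finite limit
      (∀ a : ℕ → ℝ, (∀ k, a k ∈ Set.Ioc (0 : ℝ) 1) → Tendsto a atTop (𝓝 0) →
        ∀ g : ℕ → ℝ, (∀ k, g k ^ 2 ∈ Set.Ioc 0 (g₀ ^ 2)) →
        ∀ F : ℕ → ℝ,
          (∀ k, ∃ L : ℕ → ℕ, Tendsto L atTop atTop ∧
            Tendsto (fun j => LatticeYM.normFreeEnergy 𝒢 N d (L j) (a k) (g k)) atTop (𝓝 (F k))) →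
          ∃ φ : ℕ → ℕ, StrictMono φ ∧ ∃ f : ℝ, Tendsto (fun k => F (φ k)) atTop (𝓝 f)) := by
  have hd4 : d ≤ 4 := by omega
  have hd2 : 2 ≤ d := by omega
  have hD := LatticeYM.dim_pos 𝒢 N hN hSU
  obtain ⟨cl, cu, hb⟩ := LatticeYM.exists_stability_bounds 𝒢 N hN hD d hd4 g₀ hg₀
  have hmem : ∀ L : ℕ, 2 ≤ L → ∀ a ∈ Set.Ioc (0 : ℝ) 1, ∀ g : ℝ, g ^ 2 ∈ Set.Ioc 0 (g₀ ^ 2) →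
      LatticeYM.normFreeEnergy 𝒢 N d L a g ∈ Set.Icc cl cu := by
    intro L hL a ha g hg
    have hR : 0 < LatticeYM.retained d L := LatticeYM.retained_pos hd2 hL
    obtain ⟨h1, h2⟩ := hb L a ha g hg
    have hZ := (Real.exp_pos _).trans_le h1
    rw [← Real.le_log_iff_exp_le hZ] at h1
    rw [← Real.log_le_iff_le_exp hZ] at h2
    have hpos : 0 < (𝒢.dim N : ℝ) * (LatticeYM.retained d L : ℝ) := by positivity
    rw [LatticeYM.normFreeEnergy, Set.mem_Icc, le_div_iff₀ hpos, div_le_iff₀ hpos, ← mul_assoc,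
      ← mul_assoc]
    exact ⟨h1, h2⟩
  have hcoup : ∀ a ∈ Set.Ioc (0 : ℝ) 1, ∀ g : ℝ, g ^ 2 ∈ Set.Ioc 0 (g₀ ^ 2) →
      0 < LatticeYM.coupling d a g := fun a ha g hg =>
    lt_of_lt_of_le (by positivity) (LatticeYM.coupling_ge hd4 ha hg)
  refine ⟨cl, cu, fun L _ => hb L, fun L hL a ha g hg => ⟨?_, hmem L hL a ha g hg⟩, ?_, ?_⟩
  · exact LatticeYM.freeEnergy_eq (hcoup a ha g hg)
      ((Real.exp_pos _).trans_le (hb L a ha g hg).1) hD (LatticeYM.retained_pos hd2 hL)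
  · intro a ha g hg L hL
    -- The first terms may have `L ≤ 1`, where no bond is retained and the quotient is the default
    -- `0`; a shift by `n` skips them.
    obtain ⟨n, hn⟩ := eventually_atTop.1 (hL.eventually_ge_atTop 2)
    obtain ⟨f, -, φ, hφ, hf⟩ := isCompact_Icc.tendsto_subseq
      (x := fun j => LatticeYM.normFreeEnergy 𝒢 N d (L (j + n)) a g)
      (fun j => hmem _ (hn _ (Nat.le_add_left n j)) a ha g hg)
    exact ⟨fun j => φ j + n, fun i j hij => Nat.add_lt_add_right (hφ hij) n, f, hf⟩
  · intro a ha _ g hg F hF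
    -- The constants do not depend on `a` or `g`, so one closed interval contains every
    -- thermodynamic limit.
    have hFmem : ∀ k, F k ∈ Set.Icc cl cu := fun k => by
      obtain ⟨L, hL, hlim⟩ := hF k
      exact isClosed_Icc.mem_of_tendsto hlim ((hL.eventually_ge_atTop 2).mono fun j hj =>
        hmem _ hj _ (ha k) _ (hg k))
    obtain ⟨f, -, φ, hφ, hf⟩ := isCompact_Icc.tendsto_subseq hFmem
    exact ⟨φ, hφ, f, hf⟩

end
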